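/- Let $\mathbf{k}$ be a field, let $S=\mathbf{k}[x_0,\dots,x_n]$ with its standard grading ($\deg x_i = 1$), let $I\subseteq S$ be a homogeneous ideal, and let $R=S/I$. Let $d$ be the Krull dimension of $R$. For a graded $R$-module $M$ and $i \in \mathbb{Z}$, let $M(i)$ denote the twist with components $M(i)_l = M_{i+l}$. For a (cohomologically indexed, possibly unbounded) complex $C$ of graded $R$-modules and a graded $R$-module $D$, let $$\underline{\mathrm{Ext}}^j_R(C,D)=\bigoplus_{i\in\mathbb{Z}}\mathrm{Hom}\bigl(C,\,D(i)[j]\bigr),$$ where $\mathrm{Hom}$ is taken in the derived category of graded $R$-modules (with degree-preserving maps); this is a graded $R$-module. Assume that $R$ is (graded) Gorenstein, i.e. $\underline{\mathrm{Ext}}^d_R(\mathbf{k},R)\cong\mathbf{k}(a)$ as graded $R$-modules for some $a\in\mathbb{Z}$, and $\underline{\mathrm{Ext}}^i_R(\mathbf{k},R)=0$ for all $i\neq d$; here $\mathbf{k}=R/(x_0,\dots,x_n)$ (so $R\neq 0$). Let $C$ be a complex of finitely generated graded $R$-modules, and let $s,u\in\mathbb{Z}$. If $H^j(C)=0$ unless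 $s\le j\le u$, then $\underline{\mathrm{Ext}}^j_R(C,R)=0$ unless $-u\le j\le d-s$. -/

import Mathlib

open CategoryTheory CategoryTheory.Limits

universe u v w

/-! ### Decompositions from projections -/

/-- A family of additive subgroups spanning `M`, with a compatible family of additive projections,
is a direct sum decomposition. -/
@[reducible]
noncomputable def decompositionOfProj {M σ : Type*} [AddCommGroup M] [SetLike σ M]
    [AddSubgroupClass σ M] (deg : ℤ → σ) (p : ℤ → M →+ M)
    (same : ∀ i, ∀ x ∈ deg i, p i x = x)
    (ne : ∀ i j, j ≠ i → ∀ x ∈ deg i, p j x = 0)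
    (span : ∀ x, x ∈ AddSubmonoid.closure (⋃ i, (deg i : Set M))) :
    DirectSum.Decomposition deg :=
  DirectSum.IsInternal.chooseDecomposition deg <| by
    have key : ∀ (y : DirectSum ℤ fun i => deg i) (j : ℤ),
        p j (DirectSum.coeAddMonoidHom deg y) = y j := by
      intro y j
      induction y using DirectSum.induction_on with
      | zero => simp
      | of i x =>
        rw [DirectSum.coeAddMonoidHom_of]
        by_cases h : j = i
        · subst h
          rw [same _ _ x.2, DirectSum.of_eq_same]
        · rw [ne i j h _ x.2, DirectSum.of_eq_of_ne _ _ _ h]; rfl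
      | add x y hx hy => rw [map_add, map_add, hx, hy, DirectSum.add_apply]; rfl
    constructor
    · intro x y hxy
      ext j
      rw [← key, ← key, hxy]
    · intro x
      induction span x using AddSubmonoid.closure_induction with
      | mem x hx =>
        obtain ⟨i, hi⟩ := Set.mem_iUnion.1 hx
        exact ⟨DirectSum.of (fun i => deg i) i ⟨x, hi⟩, DirectSum.coeAddMonoidHom_of deg i _⟩
      | zero => exact ⟨0, map_zero _⟩
      | add x y _ _ hx hy =>
        obtain ⟨a, rfl⟩ := hx
        obtain ⟨b, rfl⟩ := hy
        exact ⟨a + b, map_add _ _ _⟩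

/-- The projection onto the `i`-th component of a decomposition. -/
def decompProj {M σ : Type*} [AddCommGroup M] [SetLike σ M] [AddSubgroupClass σ M]
    (deg : ℤ → σ) [DirectSum.Decomposition deg] (i : ℤ) : M →+ M where
  toFun x := (DirectSum.decompose deg x i : M)
  map_zero' := by simp
  map_add' x y := by simp

theorem decompProj_mem {M σ : Type*} [AddCommGroup M] [SetLike σ M] [AddSubgroupClass σ M]
    (deg : ℤ → σ) [DirectSum.Decomposition deg] (i : ℤ) (x : M) : decompProj deg i x ∈ deg i :=
  (DirectSum.decompose deg x i).2

theorem decompProj_same {M σ : Type*} [AddCommGroup M] [SetLike σ M] [AddSubgroupClass σ M]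
    (deg : ℤ → σ) [DirectSum.Decomposition deg] (i : ℤ) (x : M) (hx : x ∈ deg i) :
    decompProj deg i x = x :=
  DirectSum.decompose_of_mem_same deg hx

theorem decompProj_ne {M σ : Type*} [AddCommGroup M] [SetLike σ M] [AddSubgroupClass σ M]
    (deg : ℤ → σ) [DirectSum.Decomposition deg] (i j : ℤ) (h : j ≠ i) (x : M) (hx : x ∈ deg i) :
    decompProj deg j x = 0 :=
  DirectSum.decompose_of_mem_ne deg hx h.symm

theorem decompProj_span {M σ : Type*} [AddCommGroup M] [SetLike σ M] [AddSubgroupClass σ M]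
    (deg : ℤ → σ) [DirectSum.Decomposition deg] (x : M) :
    x ∈ AddSubmonoid.closure (⋃ i, (deg i : Set M)) := by
  induction x using DirectSum.Decomposition.inductionOn deg with
  | zero => exact zero_mem _
  | homogeneous m => exact AddSubmonoid.subset_closure (Set.mem_iUnion.2 ⟨_, m.2⟩)
  | add x y hx hy => exact add_mem hx hy

theorem sum_decompProj {M σ : Type*} [AddCommGroup M] [SetLike σ M] [AddSubgroupClass σ M]
    (deg : ℤ → σ) [DirectSum.Decomposition deg] (x : M) :
    ∃ s : Finset ℤ, x = ∑ i ∈ s, decompProj deg i x := by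
  classical
  exact ⟨_, (DirectSum.sum_support_decompose deg x).symm⟩

/-! ### Graded modules -/

/-- A `ℤ`-graded module over the `ℤ`-graded ring `A = ⨁ 𝒜 i`. -/
structure GrMod {k A : Type u} [CommRing k] [CommRing A] [Algebra k A]
    (𝒜 : ℤ → Submodule k A) where
  carrier : Type v
  [addCommGroup : AddCommGroup carrier]
  [module : Module A carrier]
  /-- The homogeneous components. -/
  deg : ℤ → AddSubgroup carrier
  [decomposition : DirectSum.Decomposition deg]
  [gradedSMul : SetLike.GradedSMul 𝒜 deg]

namespace GrMod

attribute [instance] GrMod.addCommGroup GrMod.module GrMod.decomposition GrMod.gradedSMul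

section

variable {k A : Type u} [CommRing k] [CommRing A] [Algebra k A] {𝒜 : ℤ → Submodule k A}

theorem smul_mem_deg (M : GrMod.{u, v} 𝒜) {e i l : ℤ} (h : e + i = l) {a : A} {x : M.carrier}
    (ha : a ∈ 𝒜 e) (hx : x ∈ M.deg i) : a • x ∈ M.deg l :=
  h ▸ SetLike.GradedSMul.smul_mem ha hx

/-- The `A`-linear maps preserving internal degrees. -/
def homSubgroup (M N : GrMod.{u, v} 𝒜) : AddSubgroup (M.carrier →ₗ[A] N.carrier) where
  carrier := {f | ∀ i, ∀ x ∈ M.deg i, f x ∈ N.deg i}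
  zero_mem' _ _ _ := zero_mem _
  add_mem' hf hg i x hx := add_mem (hf i x hx) (hg i x hx)
  neg_mem' hf i x hx := neg_mem (hf i x hx)

instance : Category.{v} (GrMod.{u, v} 𝒜) where
  Hom M N := homSubgroup M N
  id M := ⟨LinearMap.id, fun _ _ hx => hx⟩
  comp f g := ⟨g.1.comp f.1, fun i x hx => g.2 i _ (f.2 i x hx)⟩

/-- The underlying linear map of a morphism of graded modules. -/
def lin {M N : GrMod.{u, v} 𝒜} (f : M ⟶ N) : M.carrier →ₗ[A] N.carrier := f.1

theorem lin_mem {M N : GrMod.{u, v} 𝒜} (f : M ⟶ N) {i : ℤ} {x : M.carrier} (hx : x ∈ M.deg i) :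
    lin f x ∈ N.deg i := f.2 i x hx

/-- Build a morphism of graded modules. -/
def mkHom {M N : GrMod.{u, v} 𝒜} (f : M.carrier →ₗ[A] N.carrier)
    (hf : ∀ i, ∀ x ∈ M.deg i, f x ∈ N.deg i) : M ⟶ N := ⟨f, hf⟩

@[simp] theorem lin_mkHom {M N : GrMod.{u, v} 𝒜} (f : M.carrier →ₗ[A] N.carrier)
    (hf : ∀ i, ∀ x ∈ M.deg i, f x ∈ N.deg i) : lin (mkHom f hf) = f := rfl

@[ext] theorem hom_ext {M N : GrMod.{u, v} 𝒜} {f g : M ⟶ N} (h : ∀ x, lin f x = lin g x) :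
    f = g := Subtype.ext (LinearMap.ext h)

@[simp] theorem lin_id (M : GrMod.{u, v} 𝒜) : lin (𝟙 M) = LinearMap.id := rfl

@[simp] theorem lin_comp {M N P : GrMod.{u, v} 𝒜} (f : M ⟶ N) (g : N ⟶ P) :
    lin (f ≫ g) = (lin g).comp (lin f) := rfl

instance : Preadditive (GrMod.{u, v} 𝒜) where
  homGroup M N := inferInstanceAs (AddCommGroup (homSubgroup M N))
  add_comp _ _ _ f f' g := Subtype.ext (LinearMap.comp_add f.1 f'.1 g.1)
  comp_add _ _ _ f g g' := Subtype.ext (LinearMap.add_comp f.1 g'.1 g.1)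

@[simp] theorem lin_zero (M N : GrMod.{u, v} 𝒜) : lin (0 : M ⟶ N) = 0 := rfl

@[simp] theorem lin_add {M N : GrMod.{u, v} 𝒜} (f g : M ⟶ N) : lin (f + g) = lin f + lin g := rfl

theorem lin_proj {M N : GrMod.{u, v} 𝒜} (f : M ⟶ N) (i : ℤ) (x : M.carrier) :
    lin f (decompProj M.deg i x) = decompProj N.deg i (lin f x) := by
  induction x using DirectSum.Decomposition.inductionOn M.deg with
  | zero => simp
  | @homogeneous j m =>
    by_cases h : i = j
    · subst h
      rw [decompProj_same _ _ _ m.2, decompProj_same _ _ _ (lin_mem f m.2)]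
    · rw [decompProj_ne _ _ _ h _ m.2, decompProj_ne _ _ _ h _ (lin_mem f m.2), map_zero]
  | add x y hx hy => simp only [map_add, hx, hy]

/-- An element whose image under an injective morphism is homogeneous is homogeneous. -/
theorem mem_deg_of_injective {M N : GrMod.{u, v} 𝒜} (f : M ⟶ N)
    (hf : Function.Injective (lin f)) {i : ℤ} {x : M.carrier} (hx : lin f x ∈ N.deg i) :
    x ∈ M.deg i := by
  have : decompProj M.deg i x = x := hf (by rw [lin_proj, decompProj_same _ _ _ hx])
  exact this ▸ decompProj_mem M.deg i x

/-- A homogeneous submodule, as a graded module. -/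
noncomputable def sub (M : GrMod.{u, v} 𝒜) (N : Submodule A M.carrier)
    (hN : N.IsHomogeneous M.deg) : GrMod.{u, v} 𝒜 :=
  let deg' : ℤ → AddSubgroup N := fun i => (M.deg i).comap N.subtype.toAddMonoidHom
  let p : ℤ → N →+ N := fun i =>
    { toFun := fun x => ⟨decompProj M.deg i x, hN i x.2⟩
      map_zero' := Subtype.ext (map_zero _)
      map_add' := fun _ _ => Subtype.ext (map_add _ _ _) }
  { carrier := N
    deg := deg'
    decomposition := decompositionOfProj deg' p
      (fun i x hx => Subtype.ext (decompProj_same M.deg i _ hx))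
      (fun i j h x hx => Subtype.ext (decompProj_ne M.deg i j h _ hx))
      (fun x => by
        obtain ⟨s, hs⟩ := sum_decompProj M.deg x.1
        have : x = ∑ i ∈ s, p i x := by
          apply Subtype.ext
          rw [AddSubmonoidClass.coe_finsetSum]
          exact hs
        rw [this]
        exact sum_mem fun i _ => AddSubmonoid.subset_closure
          (Set.mem_iUnion.2 ⟨i, decompProj_mem M.deg i x.1⟩))
    gradedSMul := ⟨fun {_ _ _ x} ha hx => M.smul_mem_deg rfl ha (x := x.1) hx⟩ }

/-- The quotient by a homogeneous submodule, as a graded module. -/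
noncomputable def quot (M : GrMod.{u, v} 𝒜) (N : Submodule A M.carrier)
    (hN : N.IsHomogeneous M.deg) : GrMod.{u, v} 𝒜 :=
  let deg' : ℤ → AddSubgroup (M.carrier ⧸ N) := fun i => (M.deg i).map N.mkQ.toAddMonoidHom
  let p : ℤ → (M.carrier ⧸ N) →+ (M.carrier ⧸ N) := fun i =>
    QuotientAddGroup.lift N.toAddSubgroup (N.mkQ.toAddMonoidHom.comp (decompProj M.deg i))
      (fun _ hx => (Submodule.Quotient.mk_eq_zero N).2 (hN i hx))
  { carrier := M.carrier ⧸ N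
    deg := deg'
    decomposition := decompositionOfProj deg' p
      (fun i x hx => by
        obtain ⟨y, hy, rfl⟩ := hx
        exact congrArg N.mkQ (decompProj_same M.deg i y hy))
      (fun i j h x hx => by
        obtain ⟨y, hy, rfl⟩ := hx
        exact (congrArg N.mkQ (decompProj_ne M.deg i j h y hy)).trans (map_zero _))
      (fun x => by
        obtain ⟨y, rfl⟩ := N.mkQ_surjective x
        obtain ⟨s, hs⟩ := sum_decompProj M.deg y
        rw [hs, map_sum]
        exact sum_mem fun i _ => AddSubmonoid.subset_closure
          (Set.mem_iUnion.2 ⟨i, _, decompProj_mem M.deg i y, rfl⟩))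
    gradedSMul := ⟨fun {_ _ a _} ha hx => by
      obtain ⟨y, hy, rfl⟩ := hx
      exact ⟨a • y, M.smul_mem_deg rfl ha hy, map_smul N.mkQ a y⟩⟩ }

/-- The twist `M(j)`, with components `M(j)_i = M_{i+j}`. -/
noncomputable def twist (M : GrMod.{u, v} 𝒜) (j : ℤ) : GrMod.{u, v} 𝒜 :=
  let deg' : ℤ → AddSubgroup M.carrier := fun i => M.deg (i + j)
  { carrier := M.carrier
    deg := deg'
    decomposition := decompositionOfProj deg' (fun i => decompProj M.deg (i + j))
      (fun i x hx => decompProj_same M.deg (i + j) x hx)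
      (fun i l h x hx => decompProj_ne M.deg (i + j) (l + j) (by simpa using h) x hx)
      (fun x => by
        have : (⋃ i, (deg' i : Set M.carrier)) = ⋃ i, (M.deg i : Set M.carrier) :=
          (Equiv.addRight j).surjective.iUnion_comp fun i => (M.deg i : Set M.carrier)
        rw [this]
        exact decompProj_span M.deg x)
    gradedSMul := ⟨fun {e i _ _} ha hx => M.smul_mem_deg (e := e) (i := i + j)
      (by simp only [vadd_eq_add]; ring) ha hx⟩ }

/-- The direct sum of two graded modules. -/
noncomputable def prod (M N : GrMod.{u, v} 𝒜) : GrMod.{u, v} 𝒜 :=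
  let deg' : ℤ → AddSubgroup (M.carrier × N.carrier) := fun i => (M.deg i).prod (N.deg i)
  let p : ℤ → (M.carrier × N.carrier) →+ (M.carrier × N.carrier) := fun i =>
    (decompProj M.deg i).prodMap (decompProj N.deg i)
  { carrier := M.carrier × N.carrier
    deg := deg'
    decomposition := decompositionOfProj deg' p
      (fun i x hx => Prod.ext (decompProj_same M.deg i _ hx.1) (decompProj_same N.deg i _ hx.2))
      (fun i j h x hx =>
        Prod.ext (decompProj_ne M.deg i j h _ hx.1) (decompProj_ne N.deg i j h _ hx.2))
      (fun x => by
        obtain ⟨s, hs⟩ := sum_decompProj M.deg x.1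
        obtain ⟨t, ht⟩ := sum_decompProj N.deg x.2
        have : x = ∑ i ∈ s, (AddMonoidHom.inl M.carrier N.carrier) (decompProj M.deg i x.1)
            + ∑ i ∈ t, (AddMonoidHom.inr M.carrier N.carrier) (decompProj N.deg i x.2) := by
          rw [← map_sum, ← map_sum, ← hs, ← ht]
          simp
        rw [this]
        refine add_mem (sum_mem fun i _ => ?_) (sum_mem fun i _ => ?_)
        · exact AddSubmonoid.subset_closure
            (Set.mem_iUnion.2 ⟨i, decompProj_mem M.deg i x.1, zero_mem _⟩)
        · exact AddSubmonoid.subset_closure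
            (Set.mem_iUnion.2 ⟨i, zero_mem _, decompProj_mem N.deg i x.2⟩))
    gradedSMul := ⟨fun {_ _ _ _} ha hx =>
      ⟨M.smul_mem_deg rfl ha hx.1, N.smul_mem_deg rfl ha hx.2⟩⟩ }

/-- The zero graded module. -/
noncomputable def zeroObj : GrMod.{u, v} 𝒜 :=
  let deg' : ℤ → AddSubgroup PUnit.{v + 1} := fun _ => ⊤
  { carrier := PUnit.{v + 1}
    deg := deg'
    decomposition := decompositionOfProj deg' (fun _ => 0)
      (fun _ _ _ => rfl) (fun _ _ _ _ _ => rfl) (fun _ => zero_mem _)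
    gradedSMul := ⟨fun {_ _ _ _} _ _ => trivial⟩ }

/-! ### Graded modules form an abelian category -/

theorem ker_isHomogeneous {M N : GrMod.{u, v} 𝒜} (f : M ⟶ N) :
    (LinearMap.ker (lin f)).IsHomogeneous M.deg := by
  intro i x hx
  have h : lin f x = 0 := hx
  exact (lin_proj f i x).trans (by rw [h, map_zero])

theorem range_isHomogeneous {M N : GrMod.{u, v} 𝒜} (f : M ⟶ N) :
    (LinearMap.range (lin f)).IsHomogeneous N.deg := by
  rintro i _ ⟨x, rfl⟩
  exact ⟨decompProj M.deg i x, lin_proj f i x⟩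

/-- The kernel of a morphism. -/
noncomputable def ker {M N : GrMod.{u, v} 𝒜} (f : M ⟶ N) : GrMod.{u, v} 𝒜 :=
  M.sub (LinearMap.ker (lin f)) (ker_isHomogeneous f)

/-- The inclusion of the kernel. -/
noncomputable def kerι {M N : GrMod.{u, v} 𝒜} (f : M ⟶ N) : ker f ⟶ M :=
  mkHom (M := ker f) (LinearMap.ker (lin f)).subtype (fun _ _ hx => hx)

theorem kerι_comp {M N : GrMod.{u, v} 𝒜} (f : M ⟶ N) : kerι f ≫ f = 0 :=
  hom_ext fun x => x.2

/-- The cokernel of a morphism. -/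
noncomputable def coker {M N : GrMod.{u, v} 𝒜} (f : M ⟶ N) : GrMod.{u, v} 𝒜 :=
  N.quot (LinearMap.range (lin f)) (range_isHomogeneous f)

/-- The projection onto the cokernel. -/
noncomputable def cokerπ {M N : GrMod.{u, v} 𝒜} (f : M ⟶ N) : N ⟶ coker f :=
  mkHom (N := coker f) (LinearMap.range (lin f)).mkQ (fun _ x hx => ⟨x, hx, rfl⟩)

theorem comp_cokerπ {M N : GrMod.{u, v} 𝒜} (f : M ⟶ N) : f ≫ cokerπ f = 0 :=
  hom_ext fun x => (Submodule.Quotient.mk_eq_zero _).2 ⟨x, rfl⟩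

theorem exists_lift {K M N Z : GrMod.{u, v} 𝒜} (ι : K ⟶ M) (f : M ⟶ N)
    (inj : Function.Injective (lin ι)) (ex : ∀ x, lin f x = 0 → ∃ y, lin ι y = x)
    (g : Z ⟶ M) (hg : g ≫ f = 0) : ∃ l : Z ⟶ K, l ≫ ι = g := by
  have h0 : ∀ z, ∃ y, lin ι y = lin g z := fun z =>
    ex _ (congrArg (fun h : Z ⟶ N => lin h z) hg)
  choose l hl using h0
  exact ⟨mkHom
    { toFun := l
      map_add' := fun x y => inj (by simp only [map_add, hl])
      map_smul' := fun a x => inj (by simp only [map_smul, hl, RingHom.id_apply]) }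
    (fun i z hz => mem_deg_of_injective ι inj (by
      change lin ι (l z) ∈ _
      rw [hl]
      exact lin_mem g hz)), hom_ext hl⟩

theorem exists_desc {M N Q Z : GrMod.{u, v} 𝒜} (f : M ⟶ N) (π : N ⟶ Q)
    (surj : Function.Surjective (lin π)) (ex : ∀ x, lin π x = 0 → ∃ y, lin f y = x)
    (g : N ⟶ Z) (hg : f ≫ g = 0) : ∃ l : Q ⟶ Z, π ≫ l = g := by
  have h0 : ∀ x y, lin π x = lin π y → lin g x = lin g y := fun x y hxy => by
    obtain ⟨m, hm⟩ := ex (x - y) (by rw [map_sub, hxy, sub_self])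
    have : lin g (lin f m) = 0 := congrArg (fun h : M ⟶ Z => lin h m) hg
    rw [hm, map_sub] at this
    exact sub_eq_zero.1 this
  choose r hr using surj
  have h1 : ∀ x, lin g (r (lin π x)) = lin g x := fun x => h0 _ _ (hr _)
  exact ⟨mkHom
    { toFun := fun q => lin g (r q)
      map_add' := fun x y => by
        rw [← map_add]
        exact h0 _ _ (by simp only [map_add, hr])
      map_smul' := fun a x => by
        rw [RingHom.id_apply, ← map_smul]
        exact h0 _ _ (by simp only [map_smul, hr]) }
    (fun i q hq => by
      have h2 : lin π (decompProj N.deg i (r q)) = lin π (r q) := by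
        rw [lin_proj, decompProj_same _ _ _ (by rw [hr]; exact hq)]
      change lin g (r q) ∈ _
      rw [← h0 _ _ h2]
      exact lin_mem g (decompProj_mem N.deg i _)), hom_ext h1⟩

/-- An injective morphism is a kernel of any morphism with which it forms an exact pair. -/
noncomputable def isKernelOfExact {K M N : GrMod.{u, v} 𝒜} (ι : K ⟶ M) (f : M ⟶ N)
    (w : ι ≫ f = 0) (inj : Function.Injective (lin ι))
    (ex : ∀ x, lin f x = 0 → ∃ y, lin ι y = x) : IsLimit (KernelFork.ofι ι w) :=
  KernelFork.IsLimit.ofι ι w (fun g hg => (exists_lift ι f inj ex g hg).choose)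
    (fun g hg => (exists_lift ι f inj ex g hg).choose_spec)
    (fun g hg _ hm => hom_ext fun x => inj
      (congrArg (fun h : _ ⟶ M => lin h x)
        (hm.trans (exists_lift ι f inj ex g hg).choose_spec.symm)))

/-- A surjective morphism is a cokernel of any morphism with which it forms an exact pair. -/
noncomputable def isCokernelOfExact {M N Q : GrMod.{u, v} 𝒜} (f : M ⟶ N) (π : N ⟶ Q)
    (w : f ≫ π = 0) (surj : Function.Surjective (lin π))
    (ex : ∀ x, lin π x = 0 → ∃ y, lin f y = x) : IsColimit (CokernelCofork.ofπ π w) :=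
  CokernelCofork.IsColimit.ofπ π w (fun g hg => (exists_desc f π surj ex g hg).choose)
    (fun g hg => (exists_desc f π surj ex g hg).choose_spec)
    (fun g hg _ hm => hom_ext fun x => by
      obtain ⟨y, rfl⟩ := surj x
      exact congrArg (fun h : N ⟶ _ => lin h y)
        (hm.trans (exists_desc f π surj ex g hg).choose_spec.symm))

instance : HasKernels (GrMod.{u, v} 𝒜) where
  has_limit f := ⟨⟨⟨_, isKernelOfExact (kerι f) f (kerι_comp f) Subtype.val_injective
    (fun x hx => ⟨⟨x, hx⟩, rfl⟩)⟩⟩⟩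

instance : HasCokernels (GrMod.{u, v} 𝒜) where
  has_colimit f := ⟨⟨⟨_, isCokernelOfExact f (cokerπ f) (comp_cokerπ f)
    (Submodule.mkQ_surjective _) (fun _ hx => (Submodule.Quotient.mk_eq_zero _).1 hx)⟩⟩⟩

theorem injective_of_mono {M N : GrMod.{u, v} 𝒜} (f : M ⟶ N) [Mono f] :
    Function.Injective (lin f) := by
  have h : kerι f = 0 := by
    rw [← cancel_mono f, kerι_comp, zero_comp]
  rw [← LinearMap.ker_eq_bot, eq_bot_iff]
  intro x hx
  exact congrArg (fun g : ker f ⟶ M => lin g ⟨x, hx⟩) h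

theorem surjective_of_epi {M N : GrMod.{u, v} 𝒜} (f : M ⟶ N) [Epi f] :
    Function.Surjective (lin f) := by
  have h : cokerπ f = 0 := by
    rw [← cancel_epi f, comp_cokerπ, comp_zero]
  intro x
  have : (LinearMap.range (lin f)).mkQ x = 0 := congrArg (fun g : N ⟶ coker f => lin g x) h
  exact (Submodule.Quotient.mk_eq_zero _).1 this

instance : HasTerminal (GrMod.{u, v} 𝒜) :=
  IsTerminal.hasTerminal (X := zeroObj) <|
    IsTerminal.ofUniqueHom (fun _ => 0) (fun _ _ => hom_ext fun _ => rfl)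

instance : HasBinaryProducts (GrMod.{u, v} 𝒜) :=
  have (M N : GrMod.{u, v} 𝒜) : HasLimit (pair M N) :=
    ⟨⟨⟨_, BinaryFan.isLimitMk (W := M.prod N)
      (fst := mkHom (M := M.prod N) (LinearMap.fst A M.carrier N.carrier) (fun _ _ hx => hx.1))
      (snd := mkHom (M := M.prod N) (LinearMap.snd A M.carrier N.carrier) (fun _ _ hx => hx.2))
      (fun s => mkHom (N := M.prod N) ((lin s.fst).prod (lin s.snd))
        (fun _ _ hx => ⟨lin_mem s.fst hx, lin_mem s.snd hx⟩))
      (fun _ => hom_ext fun _ => rfl) (fun _ => hom_ext fun _ => rfl)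
      (fun s _ h1 h2 => hom_ext fun x => Prod.ext
        (congrArg (fun g : s.pt ⟶ M => lin g x) h1)
        (congrArg (fun g : s.pt ⟶ N => lin g x) h2))⟩⟩⟩
  hasBinaryProducts_of_hasLimit_pair _

noncomputable instance : Abelian (GrMod.{u, v} 𝒜) where
  normalMonoOfMono f _ := ⟨
    { Z := coker f
      g := cokerπ f
      w := comp_cokerπ f
      isLimit := isKernelOfExact f (cokerπ f) (comp_cokerπ f) (injective_of_mono f)
        (fun _ hx => (Submodule.Quotient.mk_eq_zero _).1 hx) }⟩
  normalEpiOfEpi f _ := ⟨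
    { W := ker f
      g := kerι f
      w := kerι_comp f
      isColimit := isCokernelOfExact (kerι f) f (kerι_comp f) (surjective_of_epi f)
        (fun x hx => ⟨⟨x, hx⟩, rfl⟩) }⟩
  has_finite_products := hasFiniteProducts_of_has_binary_and_terminal

/-- The derived category of graded modules: the localization of the category of cochain complexes
at the quasi-isomorphisms. -/
noncomputable instance : HasDerivedCategory.{u + 1} (GrMod.{u, u} 𝒜) :=
  HasDerivedCategory.standard _

/-- An isomorphism of graded modules (possibly in different universes). -/
def GrIso (M : GrMod.{u, v} 𝒜) (N : GrMod.{u, w} 𝒜) : Prop :=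
  ∃ f : M.carrier ≃ₗ[A] N.carrier, ∀ i x, x ∈ M.deg i ↔ f x ∈ N.deg i

end

section

variable {k A : Type u} [CommRing k] [CommRing A] [Algebra k A]

/-- The graded ring, as a graded module over itself. -/
noncomputable def self (𝒜 : ℤ → Submodule k A) [GradedAlgebra 𝒜] : GrMod.{u, u} 𝒜 :=
  let deg' : ℤ → AddSubgroup A := fun i => (𝒜 i).toAddSubgroup
  { carrier := A
    deg := deg'
    decomposition := decompositionOfProj deg' (fun i => decompProj 𝒜 i)
      (fun i x hx => decompProj_same 𝒜 i x hx)
      (fun i j h x hx => decompProj_ne 𝒜 i j h x hx)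
      (fun x => decompProj_span 𝒜 x)
    gradedSMul := ⟨fun {_ _ _ _} ha hx => SetLike.GradedMul.mul_mem (A := 𝒜) ha hx⟩ }

/-- The ideal generated by the homogeneous elements of positive degree. -/
def irrelevant (𝒜 : ℤ → Submodule k A) : Ideal A :=
  Ideal.span {a | ∃ e : ℤ, 0 < e ∧ a ∈ 𝒜 e}

/-- The same ideal, as a submodule of the graded module `A`. -/
def irrelevantSub (𝒜 : ℤ → Submodule k A) [GradedAlgebra 𝒜] : Submodule A (self 𝒜).carrier :=
  irrelevant 𝒜

theorem irrelevant_isHomogeneous (𝒜 : ℤ → Submodule k A) [GradedAlgebra 𝒜] :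
    (irrelevantSub 𝒜).IsHomogeneous (self 𝒜).deg := by
  have h : (irrelevant 𝒜).IsHomogeneous 𝒜 := Ideal.homogeneous_span 𝒜 _ (by
    rintro x ⟨e, _, hx⟩
    exact ⟨e, hx⟩)
  intro i x hx
  have h1 := h i hx
  have h2 : ∀ y : A, decompProj (self 𝒜).deg i y = decompProj 𝒜 i y := by
    intro y
    induction y using DirectSum.Decomposition.inductionOn 𝒜 with
    | zero => exact (map_zero _).trans (map_zero _).symm
    | @homogeneous j m =>
      have hm : (m : A) ∈ (self 𝒜).deg j := m.2
      by_cases hij : i = j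
      · subst hij
        rw [decompProj_same 𝒜 _ _ m.2]
        exact decompProj_same (self 𝒜).deg _ _ hm
      · rw [decompProj_ne 𝒜 _ _ hij _ m.2]
        exact decompProj_ne (self 𝒜).deg _ _ hij _ hm
    | add x y hx hy =>
      rw [map_add, ← hx, ← hy]
      exact map_add (decompProj (self 𝒜).deg i) x y
  exact (congrArg (· ∈ irrelevant 𝒜) (h2 x)).mpr h1

/-- The graded module `A / A_{>0}A`; it is the residue field when `A` is a quotient of a
polynomial ring over a field by a proper homogeneous ideal. -/
noncomputable def residue (𝒜 : ℤ → Submodule k A) [GradedAlgebra 𝒜] : GrMod.{u, u} 𝒜 :=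
  (self 𝒜).quot (irrelevantSub 𝒜) (irrelevant_isHomogeneous 𝒜)

end

/-! ### Graded Ext -/

section

variable {k A : Type u} [CommRing k] [CommRing A] [Algebra k A] {𝒜 : ℤ → Submodule k A}

/-- Multiplication by a homogeneous element of degree `e`, as a map `D(i) ⟶ D(e+i)`. -/
noncomputable def mulBy (D : GrMod.{u, v} 𝒜) (e i : ℤ) :
    𝒜 e →+ (D.twist i ⟶ D.twist (e + i)) where
  toFun a := mkHom (M := D.twist i) (N := D.twist (e + i)) (LinearMap.lsmul A D.carrier a)
    (fun n x hx => D.smul_mem_deg (e := e) (i := n + i) (by ring) a.2 hx)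
  map_zero' := hom_ext fun x => zero_smul A (x : D.carrier)
  map_add' a b := hom_ext fun x => add_smul (a : A) (b : A) (x : D.carrier)

/-- The internal degree `i` part of `Ext^j(C, D)`: the group of morphisms `C ⟶ D(i)[j]` in the
derived category of graded modules. -/
abbrev ExtDeg (C : CochainComplex (GrMod.{u, u} 𝒜) ℤ) (D : GrMod.{u, u} 𝒜) (j i : ℤ) :
    Type (u + 1) :=
  DerivedCategory.Q.obj C ⟶
    ((DerivedCategory.singleFunctor (GrMod.{u, u} 𝒜) 0).obj (D.twist i))⟦j⟧

/-- Functoriality of `Ext^j(C, -)` in degree zero maps. -/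
noncomputable def extMap (C : CochainComplex (GrMod.{u, u} 𝒜) ℤ) {X Y : GrMod.{u, u} 𝒜} (j : ℤ) :
    (X ⟶ Y) →+
      ((DerivedCategory.Q.obj C ⟶
        ((DerivedCategory.singleFunctor (GrMod.{u, u} 𝒜) 0).obj X)⟦j⟧) →+
      (DerivedCategory.Q.obj C ⟶
        ((DerivedCategory.singleFunctor (GrMod.{u, u} 𝒜) 0).obj Y)⟦j⟧)) where
  toFun f :=
    { toFun := fun x => x ≫ ((DerivedCategory.singleFunctor (GrMod.{u, u} 𝒜) 0).map f)⟦j⟧'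
      map_zero' := zero_comp
      map_add' := fun x y => Preadditive.add_comp _ _ _ _ _ _ }
  map_zero' := by ext x; simp
  map_add' f g := by ext x; simp [Functor.map_add]

/-- The action of a homogeneous element of `A` on `⨁ i, Ext^j(C, D(i))`. -/
noncomputable def extAct (C : CochainComplex (GrMod.{u, u} 𝒜) ℤ) (D : GrMod.{u, u} 𝒜) (j e : ℤ) :
    𝒜 e →+ (DirectSum ℤ (ExtDeg C D j) →+ DirectSum ℤ (ExtDeg C D j)) where
  toFun a := DirectSum.toAddMonoid fun i =>
    (DirectSum.of (ExtDeg C D j) (e + i)).comp (extMap C j (D.mulBy e i a))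
  map_zero' := by
    refine DirectSum.addHom_ext fun i x => ?_
    rw [DirectSum.toAddMonoid_of, map_zero, map_zero]
    exact map_zero (DirectSum.of (ExtDeg C D j) (e + i))
  map_add' a b := by
    refine DirectSum.addHom_ext fun i x => ?_
    rw [AddMonoidHom.add_apply, DirectSum.toAddMonoid_of, DirectSum.toAddMonoid_of,
      DirectSum.toAddMonoid_of, map_add, map_add]
    exact map_add (DirectSum.of (ExtDeg C D j) (e + i)) _ _

theorem extAct_of (C : CochainComplex (GrMod.{u, u} 𝒜) ℤ) (D : GrMod.{u, u} 𝒜) (j e : ℤ)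
    (a : 𝒜 e) (i : ℤ) (x : ExtDeg C D j i) :
    extAct C D j e a (DirectSum.of (ExtDeg C D j) i x) =
      DirectSum.of (ExtDeg C D j) (e + i) (extMap C j (D.mulBy e i a) x) :=
  DirectSum.toAddMonoid_of _ _ _

theorem extMap_of_eq (C : CochainComplex (GrMod.{u, u} 𝒜) ℤ) (D : GrMod.{u, u} 𝒜) (j : ℤ)
    {i l l' : ℤ} (h : l = l') (f : D.twist i ⟶ D.twist l) (g : D.twist i ⟶ D.twist l')
    (hfg : ∀ x : D.carrier, (lin f x : D.carrier) = lin g x) (x : ExtDeg C D j i) :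
    DirectSum.of (ExtDeg C D j) l (extMap C j f x) =
      DirectSum.of (ExtDeg C D j) l' (extMap C j g x) := by
  subst h
  rw [show f = g from hom_ext hfg]

theorem extMap_id (C : CochainComplex (GrMod.{u, u} 𝒜) ℤ) (X : GrMod.{u, u} 𝒜) (j : ℤ)
    (x : DerivedCategory.Q.obj C ⟶
      ((DerivedCategory.singleFunctor (GrMod.{u, u} 𝒜) 0).obj X)⟦j⟧) :
    extMap C j (𝟙 X) x = x := by
  simp [extMap]

theorem extMap_comp (C : CochainComplex (GrMod.{u, u} 𝒜) ℤ) {X Y Z : GrMod.{u, u} 𝒜} (j : ℤ)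
    (f : X ⟶ Y) (g : Y ⟶ Z)
    (x : DerivedCategory.Q.obj C ⟶
      ((DerivedCategory.singleFunctor (GrMod.{u, u} 𝒜) 0).obj X)⟦j⟧) :
    extMap C j (f ≫ g) x = extMap C j g (extMap C j f x) := by
  simp [extMap]

end

section

variable {k A : Type u} [CommRing k] [CommRing A] [Algebra k A]
  {𝒜 : ℤ → Submodule k A} [GradedAlgebra 𝒜]

/-- The additive map underlying the action of `A` on `⨁ i, Ext^j(C, D(i))`. -/
noncomputable def extActAdd (C : CochainComplex (GrMod.{u, u} 𝒜) ℤ) (D : GrMod.{u, u} 𝒜) (j : ℤ) :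
    A →+ (DirectSum ℤ (ExtDeg C D j) →+ DirectSum ℤ (ExtDeg C D j)) :=
  (DirectSum.toAddMonoid fun e => extAct C D j e).comp
    (DirectSum.decomposeAddEquiv 𝒜).toAddMonoidHom

theorem extActAdd_coe (C : CochainComplex (GrMod.{u, u} 𝒜) ℤ) (D : GrMod.{u, u} 𝒜) (j : ℤ)
    {e : ℤ} (a : 𝒜 e) : extActAdd C D j (a : A) = extAct C D j e a := by
  change DirectSum.toAddMonoid _ (DirectSum.decompose 𝒜 (a : A)) = _
  rw [DirectSum.decompose_coe, DirectSum.toAddMonoid_of]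

/-- The action of `A` on `⨁ i, Ext^j(C, D(i))`. -/
noncomputable def extActRingHom (C : CochainComplex (GrMod.{u, u} 𝒜) ℤ) (D : GrMod.{u, u} 𝒜)
    (j : ℤ) : A →+* AddMonoid.End (DirectSum ℤ (ExtDeg C D j)) :=
  { extActAdd C D j with
    map_one' := by
      change extActAdd C D j ((⟨1, SetLike.GradedOne.one_mem⟩ : 𝒜 0) : A) =
        AddMonoidHom.id _
      rw [extActAdd_coe]
      refine DirectSum.addHom_ext fun i x => ?_
      rw [extAct_of]
      refine (extMap_of_eq C D j (zero_add i) (D.mulBy 0 i ⟨1, SetLike.GradedOne.one_mem⟩)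
        (𝟙 (D.twist i)) (fun y => one_smul A y) x).trans ?_
      rw [extMap_id]
      rfl
    map_mul' := by
      intro a b
      change extActAdd C D j (a * b) = (extActAdd C D j a).comp (extActAdd C D j b)
      induction a using DirectSum.Decomposition.inductionOn 𝒜 with
      | zero => rw [zero_mul, map_zero, AddMonoidHom.zero_comp]
      | add x y hx hy => rw [add_mul, map_add, hx, hy, map_add, AddMonoidHom.add_comp]
      | @homogeneous e a =>
        induction b using DirectSum.Decomposition.inductionOn 𝒜 with
        | zero => rw [mul_zero, map_zero, AddMonoidHom.comp_zero]
        | add x y hx hy => rw [mul_add, map_add, hx, hy, map_add, AddMonoidHom.comp_add]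
        | @homogeneous f b =>
          change extActAdd C D j
            ((⟨(a : A) * b, SetLike.GradedMul.mul_mem a.2 b.2⟩ : 𝒜 (e + f)) : A) = _
          rw [extActAdd_coe, extActAdd_coe, extActAdd_coe]
          refine DirectSum.addHom_ext fun i x => ?_
          rw [extAct_of]
          rw [AddMonoidHom.comp_apply, extAct_of, extAct_of, ← extMap_comp]
          exact extMap_of_eq C D j (add_assoc e f i)
            (D.mulBy (e + f) i ⟨(a : A) * b, SetLike.GradedMul.mul_mem a.2 b.2⟩)
            (D.mulBy f i b ≫ D.mulBy e (f + i) a)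
            (fun y => mul_smul (a : A) (b : A) (y : D.carrier)) x }

/-- The graded `A`-module `Ext^j(C, D) = ⨁ i, Hom(C, D(i)[j])`, for a complex `C` of graded
modules and a graded module `D`, where `Hom` is taken in the derived category of graded modules.
A homogeneous `a ∈ A` of degree `e` acts by composition with `a : D(i) ⟶ D(e+i)`. -/
noncomputable def uExt (C : CochainComplex (GrMod.{u, u} 𝒜) ℤ) (D : GrMod.{u, u} 𝒜) (j : ℤ) :
    GrMod.{u, u + 1} 𝒜 :=
  letI : Module A (DirectSum ℤ (ExtDeg C D j)) :=
    Module.compHom (DirectSum ℤ (ExtDeg C D j)) (extActRingHom C D j)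
  let deg' : ℤ → AddSubgroup (DirectSum ℤ (ExtDeg C D j)) := fun i =>
    (DirectSum.of (ExtDeg C D j) i).range
  { carrier := DirectSum ℤ (ExtDeg C D j)
    deg := deg'
    decomposition := decompositionOfProj deg'
      (fun i => (DirectSum.of (ExtDeg C D j) i).comp
        (DFinsupp.evalAddMonoidHom (β := ExtDeg C D j) i))
      (fun i x hx => by
        obtain ⟨y, rfl⟩ := hx
        exact congrArg (DirectSum.of (ExtDeg C D j) i) (DirectSum.of_eq_same i y))
      (fun i l h x hx => by
        obtain ⟨y, rfl⟩ := hx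
        exact (congrArg (DirectSum.of (ExtDeg C D j) l) (DirectSum.of_eq_of_ne i l y h)).trans
          (map_zero _))
      (fun x => by
        induction x using DirectSum.induction_on with
        | zero => exact zero_mem _
        | of i x => exact AddSubmonoid.subset_closure (Set.mem_iUnion.2 ⟨i, x, rfl⟩)
        | add x y hx hy => exact add_mem hx hy)
    gradedSMul := ⟨fun {e i a _} ha hx => by
      obtain ⟨y, rfl⟩ := hx
      refine ⟨extMap C j (D.mulBy e i ⟨a, ha⟩) y, ?_⟩
      have h1 := congrArg
        (fun g : DirectSum ℤ (ExtDeg C D j) →+ DirectSum ℤ (ExtDeg C D j) =>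
          g (DirectSum.of (ExtDeg C D j) i y)) (extActAdd_coe C D j (⟨a, ha⟩ : 𝒜 e))
      exact ((h1.trans (extAct_of C D j e ⟨a, ha⟩ i y)).symm)⟩ }

end

end GrMod

/-! ### Graded Gorenstein rings -/

/-- The graded ring `A = ⨁ 𝒜 i`, with residue module `κ = A / A_{>0}A`, is Gorenstein: its Krull dimension is
some natural number `d`, `Ext^d(κ, A) ≅ κ(a)` as graded modules for some `a`, and `Ext^i(κ, A) = 0`
for `i ≠ d`. -/
def IsGradedGorenstein {k A : Type u} [CommRing k] [CommRing A] [Algebra k A]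
    (𝒜 : ℤ → Submodule k A) [GradedAlgebra 𝒜] : Prop :=
  ∃ d : ℕ, ringKrullDim A = d ∧
    (∃ a : ℤ, GrMod.GrIso
      (GrMod.uExt ((CochainComplex.singleFunctor (GrMod.{u, u} 𝒜) 0).obj (GrMod.residue 𝒜))
        (GrMod.self 𝒜) d)
      ((GrMod.residue 𝒜).twist a)) ∧
    ∀ i : ℤ, i ≠ d → IsZero
      (GrMod.uExt ((CochainComplex.singleFunctor (GrMod.{u, u} 𝒜) 0).obj (GrMod.residue 𝒜))
        (GrMod.self 𝒜) i)

/-! ### Standard graded algebras `k[x_0, …, x_n] / I` -/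

/-- The standard grading (every variable has degree one) on `k[x_0, …, x_n]`, indexed by `ℤ`. -/
noncomputable def polyGrading (k : Type u) [Field k] (n : ℕ) :
    ℤ → Submodule k (MvPolynomial (Fin (n + 1)) k) :=
  MvPolynomial.weightedHomogeneousSubmodule k (fun _ => (1 : ℤ))

noncomputable instance (k : Type u) [Field k] (n : ℕ) : GradedAlgebra (polyGrading k n) :=
  MvPolynomial.weightedGradedAlgebra k (fun _ => (1 : ℤ))

/-- The grading induced on the quotient by a homogeneous ideal. -/
def quotGrading {k A : Type u} [CommRing k] [CommRing A] [Algebra k A] {𝒜 : ℤ → Submodule k A}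
    [GradedAlgebra 𝒜] (I : HomogeneousIdeal 𝒜) : ℤ → Submodule k (A ⧸ I.toIdeal) :=
  fun i => (𝒜 i).map (Ideal.Quotient.mkₐ k I.toIdeal).toLinearMap

noncomputable instance {k A : Type u} [CommRing k] [CommRing A] [Algebra k A]
    {𝒜 : ℤ → Submodule k A} [GradedAlgebra 𝒜] (I : HomogeneousIdeal 𝒜) :
    GradedAlgebra (quotGrading I) :=
  let q : A →+ A ⧸ I.toIdeal := (Ideal.Quotient.mk I.toIdeal).toAddMonoidHom
  { one_mem := ⟨1, SetLike.GradedOne.one_mem, rfl⟩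
    mul_mem := by
      rintro i j _ _ ⟨a, ha, rfl⟩ ⟨b, hb, rfl⟩
      exact ⟨a * b, SetLike.GradedMul.mul_mem ha hb, map_mul (Ideal.Quotient.mkₐ k I.toIdeal) a b⟩
    toDecomposition := decompositionOfProj (quotGrading I)
      (fun i => QuotientAddGroup.lift I.toIdeal.toAddSubgroup (q.comp (decompProj 𝒜 i))
        (fun _ hx => Ideal.Quotient.eq_zero_iff_mem.2 (I.isHomogeneous i hx)))
      (fun i x hx => by
        obtain ⟨y, hy, rfl⟩ := hx
        exact congrArg q (decompProj_same 𝒜 i y hy))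
      (fun i j h x hx => by
        obtain ⟨y, hy, rfl⟩ := hx
        exact (congrArg q (decompProj_ne 𝒜 i j h y hy)).trans (map_zero _))
      (fun x => by
        obtain ⟨y, rfl⟩ := Ideal.Quotient.mk_surjective x
        obtain ⟨s, hs⟩ := sum_decompProj 𝒜 y
        rw [hs, map_sum]
        exact sum_mem fun i _ => AddSubmonoid.subset_closure
          (Set.mem_iUnion.2 ⟨i, _, decompProj_mem 𝒜 i y, rfl⟩)) }

/-
If `Ext^n(k, D(l)) = 0` for the residue field `k`, all `n > d` and all twists `l`, then the same
holds with `k` replaced by any finitely generated graded module. It suffices to treat cyclic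
modules, by Noetherian induction on the annihilator. If the irrelevant ideal annihilates `M ≠ 0`,
then `M` is a twist of `k`. Otherwise pick a homogeneous `r` of degree `e > 0` with `r M ≠ 0`.
If `r` is not injective on `M`, then `r M` and `M / r M` both have strictly larger annihilators.
If it is injective, then only `M / r M` does, and the sequence `0 → M(-e) → M → M / r M → 0` shows
that `Ext^n(M, D(l)) = 0` implies `Ext^n(M, D(l + e)) = 0`; but `Ext^n(M, D(l))` vanishes for
`l ≪ 0` because `M` has a resolution by finite free modules and `D` is bounded below.
A bounded complex is then treated by dévissage along its canonical truncations.
-/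

section ExtVanishing

variable {C : Type*} [Category* C] [Abelian C]

/-- The property of objects `X` of an abelian category that `Ext^n(X, Y) = 0`. -/
def extVanishing [HasExt.{w} C] (Y : C) (n : ℕ) : ObjectProperty C :=
  fun X => Subsingleton (Abelian.Ext X Y n)

namespace extVanishing

open Abelian.Ext ZeroObject

variable [HasExt.{w} C]

theorem of_iso {X X' Y Y' : C} (e : X ≅ X') (f : Y ≅ Y') {n : ℕ} (h : extVanishing Y n X) :
    extVanishing Y' n X' := by
  have : Subsingleton (Abelian.Ext X Y n) := h
  let g (z : Abelian.Ext X' Y' n) : Abelian.Ext X Y n :=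
    ((mk₀ e.hom).comp z (zero_add n)).comp (mk₀ f.inv) (add_zero n)
  have hg (z : Abelian.Ext X' Y' n) :
      z = ((mk₀ e.inv).comp (g z) (zero_add n)).comp (mk₀ f.hom) (add_zero n) := by
    simp [g]
  exact ⟨fun x y => by rw [hg x, hg y, Subsingleton.elim (g x) (g y)]⟩

instance isClosedUnderIsomorphisms (Y : C) (n : ℕ) :
    (extVanishing Y n).IsClosedUnderIsomorphisms where
  of_iso e h := of_iso e (Iso.refl Y) h

instance containsZero (Y : C) (n : ℕ) : (extVanishing Y n).ContainsZero where
  exists_zero := ⟨0, isZero_zero C, subsingleton_of_forall_eq 0 fun f => by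
    rw [← mk₀_id_comp f, id_zero, mk₀_zero, Abelian.Ext.zero_comp]⟩

instance isClosedUnderExtensions (Y : C) (n : ℕ) : (extVanishing Y n).IsClosedUnderExtensions where
  prop_X₂_of_shortExact hS h₁ h₃ := subsingleton_of_forall_eq 0 fun x => by
    obtain ⟨y, rfl⟩ := contravariant_sequence_exact₂ hS Y x (h₁.elim _ _)
    rw [h₃.elim y 0, Abelian.Ext.comp_zero]

variable {S : ShortComplex C}

theorem X₁_of_shortExact (hS : S.ShortExact) {Y : C} {n : ℕ} (h₂ : extVanishing Y n S.X₂)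
    (h₃ : extVanishing Y (n + 1) S.X₃) : extVanishing Y n S.X₁ :=
  subsingleton_of_forall_eq 0 fun x => by
    obtain ⟨y, rfl⟩ := contravariant_sequence_exact₁ hS Y x (add_comm 1 n) (h₃.elim _ _)
    rw [h₂.elim y 0, Abelian.Ext.comp_zero]

theorem X₃_of_shortExact (hS : S.ShortExact) {Y : C} {n : ℕ} (h₁ : extVanishing Y n S.X₁)
    (h₂ : extVanishing Y (n + 1) S.X₂) : extVanishing Y (n + 1) S.X₃ :=
  subsingleton_of_forall_eq 0 fun x => by
    obtain ⟨y, rfl⟩ := contravariant_sequence_exact₃ hS Y x (h₂.elim _ _) (add_comm 1 n)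
    rw [h₁.elim y 0, Abelian.Ext.comp_zero]

end extVanishing

variable {D : Type*} [Category* D] [Abelian D] [HasDerivedCategory C] [HasDerivedCategory D]

theorem faithful_mapDerivedCategory_of_leftInverse
    (F : C ⥤ D) [F.Additive] [PreservesFiniteLimits F] [PreservesFiniteColimits F]
    (G : D ⥤ C) [G.Additive] [PreservesFiniteLimits G] [PreservesFiniteColimits G]
    (e : F ⋙ G ≅ 𝟭 C) : F.mapDerivedCategory.Faithful := by
  let W := HomologicalComplex.quasiIso C (ComplexShape.up ℤ)
  let α : F.mapHomologicalComplex (ComplexShape.up ℤ) ⋙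
      G.mapHomologicalComplex (ComplexShape.up ℤ) ≅ 𝟭 _ :=
    NatIso.mapHomologicalComplex e _ ≪≫ Functor.mapHomologicalComplexIdIso C _
  let β : DerivedCategory.Q ⋙ F.mapDerivedCategory ⋙ G.mapDerivedCategory ≅
      DerivedCategory.Q ⋙ 𝟭 _ :=
    (Functor.associator _ _ _).symm ≪≫
      Functor.isoWhiskerRight F.mapDerivedCategoryFactors _ ≪≫ Functor.associator _ _ _ ≪≫
      Functor.isoWhiskerLeft _ G.mapDerivedCategoryFactors ≪≫ (Functor.associator _ _ _).symm ≪≫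
      Functor.isoWhiskerRight α _ ≪≫ Functor.leftUnitor _ ≪≫ (Functor.rightUnitor _).symm
  let γ : F.mapDerivedCategory ⋙ G.mapDerivedCategory ≅ 𝟭 (DerivedCategory C) :=
    Localization.liftNatIso DerivedCategory.Q W _ _ _ _ β
  have : (F.mapDerivedCategory ⋙ G.mapDerivedCategory).Faithful :=
    Functor.Faithful.of_iso γ.symm
  exact Functor.Faithful.of_comp _ G.mapDerivedCategory

theorem extVanishing.of_map [HasExt.{w} C] [HasExt.{v} D]
    (F : C ⥤ D) [F.Additive] [PreservesFiniteLimits F] [PreservesFiniteColimits F]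
    (G : D ⥤ C) [G.Additive] [PreservesFiniteLimits G] [PreservesFiniteColimits G]
    (e : F ⋙ G ≅ 𝟭 C) {X Y : C} {n : ℕ} (h : extVanishing (F.obj Y) n (F.obj X)) :
    extVanishing Y n X := by
  have := faithful_mapDerivedCategory_of_leftInverse F G e
  refine ⟨fun x y => Abelian.Ext.ext (F.mapDerivedCategory.map_injective ?_)⟩
  have hxy := congrArg Abelian.Ext.hom (h.elim (x.mapExactFunctor F) (y.mapExactFunctor F))
  simpa only [Abelian.Ext.mapExactFunctor_hom, ShiftedHom.map, cancel_epi, cancel_mono] using hxy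

end ExtVanishing

section DerivedCategory

open Pretriangulated DerivedCategory

variable {C : Type*} [Category* C] [Abelian C] [HasDerivedCategory C]

theorem nonempty_iso_singleFunctor_obj_homology (X : DerivedCategory C) (t : ℤ)
    [X.IsGE t] [X.IsLE t] :
    Nonempty (X ≅ (singleFunctor C t).obj ((homologyFunctor C t).obj X)) := by
  obtain ⟨M, ⟨e⟩⟩ := exists_iso_singleFunctor_obj_of_isGE_of_isLE X t
  exact ⟨e ≪≫ (singleFunctor C t).mapIso
    (((singleFunctorCompHomologyFunctorIso C t).app M).symm ≪≫
      (homologyFunctor C t).mapIso e.symm)⟩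

theorem exists_distTriang_singleFunctor_homology (X : DerivedCategory C) (t : ℤ) [X.IsLE t] :
    ∃ (X' Y : DerivedCategory C) (f : X' ⟶ X) (g : X ⟶ Y) (h : Y ⟶ X'⟦(1 : ℤ)⟧),
      Triangle.mk f g h ∈ distTriang _ ∧ X'.IsLE (t - 1) ∧
      (∀ n < t, IsIso ((homologyFunctor C n).map f)) ∧
      Nonempty (Y ≅ (singleFunctor C t).obj ((homologyFunctor C t).obj X)) := by
  obtain ⟨X', Y, hX', hY, f, g, h, hT⟩ := TStructure.t.exists_triangle X (t - 1) t (by lia)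
  have : X'.IsLE (t - 1) := ⟨hX'⟩
  have : Y.IsGE t := ⟨hY⟩
  have hX'n (m : ℤ) (hm : t ≤ m) : IsZero ((homologyFunctor C m).obj X') :=
    X'.isZero_of_isLE (t - 1) m (by lia)
  have hYn (m : ℤ) (hm : m < t) : IsZero ((homologyFunctor C m).obj Y) := Y.isZero_of_isGE t m hm
  have hf (n : ℤ) (hn : n < t) : IsIso ((homologyFunctor C n).map f) := by
    have : Mono ((homologyFunctor C n).map f) :=
      (HomologySequence.mono_homologyMap_mor₁_iff _ hT (n - 1) n (by lia)).2
        ((hYn (n - 1) (by lia)).eq_of_src _ _)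
    have : Epi ((homologyFunctor C n).map f) :=
      (HomologySequence.epi_homologyMap_mor₁_iff _ hT n).2 ((hYn n hn).eq_of_tgt _ _)
    exact isIso_of_mono_of_epi _
  have hg (n : ℤ) (hn : t ≤ n) : IsIso ((homologyFunctor C n).map g) := by
    have : Mono ((homologyFunctor C n).map g) :=
      (HomologySequence.mono_homologyMap_mor₂_iff _ hT n).2 ((hX'n n hn).eq_of_src _ _)
    have : Epi ((homologyFunctor C n).map g) :=
      (HomologySequence.epi_homologyMap_mor₂_iff _ hT n (n + 1) rfl).2
        ((hX'n (n + 1) (by lia)).eq_of_tgt _ _)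
    exact isIso_of_mono_of_epi _
  have : Y.IsLE t := (isLE_iff _ _).2 fun n hn =>
    have := hg n hn.le
    (X.isZero_of_isLE t n hn).of_iso (asIso ((homologyFunctor C n).map g)).symm
  obtain ⟨e⟩ := nonempty_iso_singleFunctor_obj_homology Y t
  have := hg t le_rfl
  exact ⟨X', Y, f, g, h, hT, inferInstance, hf,
    ⟨e ≪≫ (singleFunctor C t).mapIso (asIso ((homologyFunctor C t).map g)).symm⟩⟩

theorem prop_of_prop_singleFunctor_homology (Q : ObjectProperty (DerivedCategory C))
    [Q.IsTriangulatedClosed₂] [Q.IsClosedUnderIsomorphisms] [Q.ContainsZero]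
    {s t : ℤ} (X : DerivedCategory C) [X.IsGE s] [X.IsLE t]
    (hX : ∀ n, s ≤ n → n ≤ t → Q ((singleFunctor C n).obj ((homologyFunctor C n).obj X))) :
    Q X := by
  obtain ⟨m, hm⟩ : ∃ m : ℕ, t < s + m := ⟨(t - s + 1).toNat, by lia⟩
  induction m generalizing t X with
  | zero => exact Q.prop_of_isZero (TStructure.t.isZero X t s (by simpa using hm))
  | succ m ih =>
    by_cases hts : t < s
    · exact Q.prop_of_isZero (TStructure.t.isZero X t s hts)
    obtain ⟨X', Y, f, g, h, hT, hX', hf, ⟨e⟩⟩ := exists_distTriang_singleFunctor_homology X t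
    have : X'.IsGE s := (isGE_iff _ _).2 fun n hn =>
      have := hf n (by lia)
      (X.isZero_of_isGE s n hn).of_iso (asIso ((homologyFunctor C n).map f))
    have hQX' : Q X' := ih (t := t - 1) X' (fun n hsn hnt =>
      have := hf n (by lia)
      Q.prop_of_iso ((singleFunctor C n).mapIso (asIso ((homologyFunctor C n).map f)).symm)
        (hX n hsn (by lia))) (by lia)
    exact Q.ext_of_isTriangulatedClosed₂ _ hT hQX' (Q.prop_of_iso e.symm (hX t (by lia) le_rfl))

theorem singleFunctor_hom_shift_eq_zero [HasExt.{w} C] {M N : C} {n j : ℤ}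
    (h : ∀ m : ℕ, j + n = m → extVanishing N m M)
    (f : (singleFunctor C n).obj M ⟶ ((singleFunctor C 0).obj N)⟦j⟧) : f = 0 := by
  by_cases hjn : j + n < 0
  · have : (((singleFunctor C 0).obj N)⟦j⟧).IsGE (-j) :=
      TStructure.t.isGE_shift _ 0 j (-j) (by lia)
    exact TStructure.t.zero_of_isLE_of_isGE f n (-j) (by lia) inferInstance this
  · obtain ⟨m, hm⟩ := Int.eq_ofNat_of_zero_le (not_lt.1 hjn)
    have : Subsingleton ((singleFunctor C 0).obj M ⟶ ((singleFunctor C 0).obj N)⟦(m : ℤ)⟧) :=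
      Abelian.Ext.homEquiv.subsingleton_congr.1 (h m hm)
    apply (shiftFunctor (DerivedCategory C) n).map_injective
    rw [Functor.map_zero,
      ← cancel_epi (((singleFunctors C).shiftIso n 0 n (by simp)).inv.app M),
      ← cancel_mono ((shiftFunctorAdd' (DerivedCategory C) j n m hm).inv.app
        ((singleFunctor C 0).obj N))]
    exact Subsingleton.elim _ _

theorem Q_obj_hom_shift_eq_zero [HasExt.{w} C] {K : CochainComplex C ℤ} {N : C} {s t j : ℤ}
    (hK : ∀ n : ℤ, ¬ (s ≤ n ∧ n ≤ t) → IsZero (K.homology n))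
    (h : ∀ n : ℤ, s ≤ n → n ≤ t → ∀ m : ℕ, j + n = m → extVanishing N m (K.homology n))
    (f : Q.obj K ⟶ ((singleFunctor C 0).obj N)⟦j⟧) : f = 0 := by
  let e (n : ℤ) : (homologyFunctor C n).obj (Q.obj K) ≅ K.homology n :=
    (homologyFunctorFactors C n).app K
  have : (Q.obj K).IsGE s := (isGE_iff _ _).2 fun n hn => (hK n (by lia)).of_iso (e n)
  have : (Q.obj K).IsLE t := (isLE_iff _ _).2 fun n hn => (hK n (by lia)).of_iso (e n)
  let P : ObjectProperty (DerivedCategory C) :=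
    (ObjectProperty.singleton (((singleFunctor C 0).obj N)⟦j⟧)).leftOrthogonal
  suffices P (Q.obj K) from this f ((ObjectProperty.singleton_iff _ _).2 rfl)
  refine prop_of_prop_singleFunctor_homology P (s := s) (t := t) _ fun n hs ht Y g hY => ?_
  obtain rfl := (ObjectProperty.singleton_iff _ _).1 hY
  exact singleFunctor_hom_shift_eq_zero
    (fun m hm => (extVanishing N m).prop_of_iso (e n).symm (h n hs ht m hm)) g

end DerivedCategory

section Annihilator

variable {A M : Type*} [CommRing A] [AddCommGroup M] [Module A M] {r : A}

theorem annihilator_lt_annihilator_quot_range_lsmul (hr : r ∉ Module.annihilator A M) :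
    Module.annihilator A M <
      Module.annihilator A (M ⧸ LinearMap.range (LinearMap.lsmul A M r)) := by
  let N := LinearMap.range (LinearMap.lsmul A M r)
  refine SetLike.lt_iff_le_and_exists.2
    ⟨N.mkQ.annihilator_le_of_surjective N.mkQ_surjective, r,
      Module.mem_annihilator.2 fun y => ?_, hr⟩
  obtain ⟨x, rfl⟩ := N.mkQ_surjective y
  exact (Submodule.Quotient.mk_eq_zero N).2 ⟨x, rfl⟩

theorem annihilator_lt_annihilator_range_lsmul {x : M} (hx : Submodule.span A {x} = ⊤)
    (hr : ¬ Function.Injective (LinearMap.lsmul A M r)) :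
    Module.annihilator A M < Module.annihilator A (LinearMap.range (LinearMap.lsmul A M r)) := by
  let φ := LinearMap.lsmul A M r
  have hgen (y : M) : ∃ c : A, c • x = y :=
    Submodule.mem_span_singleton.1 (hx ▸ Submodule.mem_top)
  obtain ⟨c, hrc, hc⟩ : ∃ c : A, r • c • x = 0 ∧ c • x ≠ 0 := by
    contrapose! hr
    refine (injective_iff_map_eq_zero φ).2 fun y hy => ?_
    obtain ⟨c, rfl⟩ := hgen y
    exact hr c hy
  refine SetLike.lt_iff_le_and_exists.2
    ⟨φ.rangeRestrict.annihilator_le_of_surjective φ.surjective_rangeRestrict, c,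
      Module.mem_annihilator.2 ?_, fun h => hc (Module.mem_annihilator.1 h x)⟩
  rintro ⟨_, y, rfl⟩
  obtain ⟨b, rfl⟩ := hgen y
  refine Subtype.ext ?_
  calc c • r • b • x = b • r • c • x := by
        rw [smul_comm r b x, smul_comm c b, smul_comm c r]
    _ = 0 := by rw [hrc, smul_zero]

end Annihilator

namespace GrMod

variable {k A : Type u} [CommRing k] [CommRing A] [Algebra k A] {𝒜 : ℤ → Submodule k A}

theorem isZero_iff_subsingleton {M : GrMod.{u, v} 𝒜} : IsZero M ↔ Subsingleton M.carrier := by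
  rw [IsZero.iff_id_eq_zero]
  exact ⟨fun h => subsingleton_of_forall_eq 0 fun x => congrArg (fun f : M ⟶ M => lin f x) h,
    fun _ => hom_ext fun _ => Subsingleton.elim _ _⟩

theorem mono_of_injective {M N : GrMod.{u, v} 𝒜} (f : M ⟶ N)
    (hf : Function.Injective (lin f)) : Mono f :=
  ⟨fun _ _ w => hom_ext fun x => hf (congrArg (fun φ => lin φ x) w)⟩

theorem epi_of_surjective {M N : GrMod.{u, v} 𝒜} (f : M ⟶ N)
    (hf : Function.Surjective (lin f)) : Epi f :=
  ⟨fun _ _ w => hom_ext fun y => by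
    obtain ⟨x, rfl⟩ := hf y
    exact congrArg (fun φ => lin φ x) w⟩

theorem isIso_of_bijective {M N : GrMod.{u, v} 𝒜} (f : M ⟶ N)
    (hf : Function.Bijective (lin f)) : IsIso f := by
  have := mono_of_injective f hf.1
  have := epi_of_surjective f hf.2
  exact isIso_of_mono_of_epi f

theorem shortExact_of_exact {K M N : GrMod.{u, v} 𝒜} (f : K ⟶ M) (g : M ⟶ N) (w : f ≫ g = 0)
    (hf : Function.Injective (lin f)) (hg : Function.Surjective (lin g))
    (ex : ∀ x, lin g x = 0 → ∃ y, lin f y = x) : (ShortComplex.mk f g w).ShortExact where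
  exact := ShortComplex.exact_of_f_is_kernel _ (isKernelOfExact f g w hf ex)
  mono_f := mono_of_injective f hf
  epi_g := epi_of_surjective g hg

theorem shortExact_kerι {M N : GrMod.{u, v} 𝒜} (f : M ⟶ N) (hf : Function.Surjective (lin f)) :
    (ShortComplex.mk (kerι f) f (kerι_comp f)).ShortExact :=
  shortExact_of_exact _ _ _ Subtype.val_injective hf fun x hx => ⟨⟨x, hx⟩, rfl⟩

theorem shortExact_cokerπ {M N : GrMod.{u, v} 𝒜} (f : M ⟶ N) (hf : Function.Injective (lin f)) :
    (ShortComplex.mk f (cokerπ f) (comp_cokerπ f)).ShortExact :=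
  shortExact_of_exact _ _ _ hf (Submodule.mkQ_surjective _)
    fun _ hx => (Submodule.Quotient.mk_eq_zero _).1 hx

/-- The inclusion of a homogeneous submodule. -/
noncomputable def subι (M : GrMod.{u, v} 𝒜) (N : Submodule A M.carrier)
    (hN : N.IsHomogeneous M.deg) : M.sub N hN ⟶ M :=
  mkHom (M := M.sub N hN) N.subtype (fun _ _ hx => hx)

/-- The projection onto the quotient by a homogeneous submodule. -/
noncomputable def quotπ (M : GrMod.{u, v} 𝒜) (N : Submodule A M.carrier)
    (hN : N.IsHomogeneous M.deg) : M ⟶ M.quot N hN :=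
  mkHom (N := M.quot N hN) N.mkQ (fun _ x hx => ⟨x, hx, rfl⟩)

theorem subι_quotπ (M : GrMod.{u, v} 𝒜) (N : Submodule A M.carrier)
    (hN : N.IsHomogeneous M.deg) : M.subι N hN ≫ M.quotπ N hN = 0 :=
  hom_ext fun x => (Submodule.Quotient.mk_eq_zero N).2 x.2

theorem shortExact_sub_quot (M : GrMod.{u, v} 𝒜) (N : Submodule A M.carrier)
    (hN : N.IsHomogeneous M.deg) :
    (ShortComplex.mk _ _ (M.subι_quotπ N hN)).ShortExact :=
  shortExact_of_exact _ _ _ Subtype.val_injective (Submodule.mkQ_surjective N)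
    (fun x hx => ⟨⟨x, (Submodule.Quotient.mk_eq_zero N).1 hx⟩, rfl⟩)

theorem mem_deg_of_eq (M : GrMod.{u, v} 𝒜) {i j : ℤ} (h : i = j) {x : M.carrier}
    (hx : x ∈ M.deg i) : x ∈ M.deg j := h ▸ hx

/-- The twist `M ↦ M(a)` as a functor. -/
noncomputable def twistFunctor (a : ℤ) : GrMod.{u, v} 𝒜 ⥤ GrMod.{u, v} 𝒜 where
  obj M := M.twist a
  map {M N} f := mkHom (M := M.twist a) (N := N.twist a) (lin (M := M) (N := N) f)
    (fun i _ hx => lin_mem (M := M) (N := N) (i := i + a) f hx)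

/-- The isomorphism `M(a)(b) ≅ M(a + b)`, given by the identity of the underlying module. -/
noncomputable def twistTwistIso (M : GrMod.{u, v} 𝒜) (a b c : ℤ) (h : a + b = c) :
    (M.twist a).twist b ≅ M.twist c where
  hom := mkHom (M := (M.twist a).twist b) (N := M.twist c) (LinearMap.id (M := M.carrier))
    fun i _ hx => M.mem_deg_of_eq (i := i + b + a) (j := i + c) (by lia) hx
  inv := mkHom (N := (M.twist a).twist b) (M := M.twist c) (LinearMap.id (M := M.carrier))
    fun i _ hx => M.mem_deg_of_eq (i := i + c) (j := i + b + a) (by lia) hx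

/-- The isomorphism `M(0) ≅ M`, given by the identity of the underlying module. -/
noncomputable def twistZeroIso (M : GrMod.{u, v} 𝒜) : M.twist 0 ≅ M where
  hom := mkHom (M := M.twist 0) (LinearMap.id (M := M.carrier))
    fun i _ hx => M.mem_deg_of_eq (i := i + 0) (j := i) (by lia) hx
  inv := mkHom (N := M.twist 0) (LinearMap.id (M := M.carrier))
    fun i _ hx => M.mem_deg_of_eq (i := i) (j := i + 0) (by lia) hx

/-- The twist by `a` as an autoequivalence, with the twist by `-a` as inverse. -/
noncomputable def twistEquivalence (a : ℤ) : GrMod.{u, v} 𝒜 ≌ GrMod.{u, v} 𝒜 :=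
  CategoryTheory.Equivalence.mk (twistFunctor a) (twistFunctor (-a))
    (NatIso.ofComponents
      (fun M => (twistZeroIso M).symm ≪≫ (twistTwistIso M a (-a) 0 (by ring)).symm)
      (fun _ => rfl))
    (NatIso.ofComponents
      (fun M => twistTwistIso M (-a) a 0 (by ring) ≪≫ twistZeroIso M)
      (fun _ => rfl))

instance (a : ℤ) : (twistFunctor a : GrMod.{u, v} 𝒜 ⥤ GrMod.{u, v} 𝒜).IsEquivalence :=
  (twistEquivalence (𝒜 := 𝒜) a).isEquivalence_functor

instance (a : ℤ) : (twistFunctor a : GrMod.{u, v} 𝒜 ⥤ GrMod.{u, v} 𝒜).Additive where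
  map_add := rfl

instance : HasExt.{u + 1} (GrMod.{u, u} 𝒜) := hasExt_of_hasDerivedCategory _

theorem extVanishing_twist_iff {M N : GrMod.{u, u} 𝒜} {n : ℕ} {a b c : ℤ} (h : b + a = c) :
    extVanishing (N.twist c) n (M.twist a) ↔ extVanishing (N.twist b) n M := by
  have of_twist {M N : GrMod.{u, u} 𝒜} (a : ℤ) :
      extVanishing (N.twist a) n (M.twist a) → extVanishing N n M :=
    extVanishing.of_map (twistFunctor a) (twistFunctor (-a))
      (twistEquivalence (𝒜 := 𝒜) a).unitIso.symm
  constructor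
  · intro hMN
    exact of_twist a (hMN.of_iso (Iso.refl _) (twistTwistIso N b a c h).symm)
  · intro hMN
    exact of_twist (-a) (hMN.of_iso ((twistEquivalence (𝒜 := 𝒜) a).unitIso.app M)
      (twistTwistIso N c (-a) b (by lia)).symm)

/-- A graded module generated by one homogeneous element. -/
def IsGradedCyclic (M : GrMod.{u, v} 𝒜) : Prop :=
  ∃ a, ∃ x ∈ M.deg a, Submodule.span A {x} = ⊤

namespace IsGradedCyclic

theorem of_surjective {M N : GrMod.{u, v} 𝒜} (hM : M.IsGradedCyclic) (f : M ⟶ N)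
    (hf : Function.Surjective (lin f)) : N.IsGradedCyclic := by
  obtain ⟨a, x, hx, hs⟩ := hM
  refine ⟨a, lin f x, lin_mem f hx, ?_⟩
  rw [← Set.image_singleton, ← Submodule.map_span, hs, ← LinearMap.range_eq_map,
    LinearMap.range_eq_top.2 hf]

theorem range {M N : GrMod.{u, v} 𝒜} (hM : M.IsGradedCyclic) (f : M ⟶ N) :
    (N.sub (LinearMap.range (lin f)) (range_isHomogeneous f)).IsGradedCyclic :=
  hM.of_surjective (mkHom (N := N.sub _ (range_isHomogeneous f)) (lin f).rangeRestrict
    fun _ _ hx => lin_mem f hx) (lin f).surjective_rangeRestrict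

theorem twist {M : GrMod.{u, v} 𝒜} (hM : M.IsGradedCyclic) (a : ℤ) :
    (M.twist a).IsGradedCyclic := by
  obtain ⟨b, x, hx, hs⟩ := hM
  exact ⟨b - a, x, M.mem_deg_of_eq (sub_add_cancel b a).symm hx, hs⟩

theorem finite {M : GrMod.{u, v} 𝒜} (hM : M.IsGradedCyclic) : Module.Finite A M.carrier := by
  obtain ⟨a, x, -, hs⟩ := hM
  exact ⟨⟨{x}, by simpa only [Finset.coe_singleton] using hs⟩⟩

end IsGradedCyclic

theorem decompProj_smul (M : GrMod.{u, v} 𝒜) {e : ℤ} {r : A} (hr : r ∈ 𝒜 e) (i : ℤ)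
    (y : M.carrier) : decompProj M.deg i (r • y) = r • decompProj M.deg (i - e) y := by
  induction y using DirectSum.Decomposition.inductionOn M.deg with
  | zero => simp only [smul_zero, map_zero]
  | @homogeneous j m =>
    have hm : r • (m : M.carrier) ∈ M.deg (e + j) := M.smul_mem_deg rfl hr m.2
    by_cases h : i = e + j
    · subst h
      rw [decompProj_same _ _ _ hm, add_sub_cancel_left, decompProj_same _ _ _ m.2]
    · rw [decompProj_ne _ _ _ h _ hm, decompProj_ne _ _ _ (by lia) _ m.2, smul_zero]
  | add x y hx hy => simp only [map_add, smul_add, hx, hy]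

theorem span_isHomogeneous [GradedAlgebra 𝒜] (M : GrMod.{u, v} 𝒜) (s : Set M.carrier)
    (hs : ∀ x ∈ s, ∃ a, x ∈ M.deg a) : (Submodule.span A s).IsHomogeneous M.deg := by
  suffices h : ∀ x ∈ Submodule.span A s, ∀ i, decompProj M.deg i x ∈ Submodule.span A s from
    fun i x hx => h x hx i
  intro x hx
  induction hx using Submodule.span_induction with
  | mem x hx =>
    intro i
    obtain ⟨a, ha⟩ := hs x hx
    by_cases h : i = a
    · subst h
      rw [decompProj_same _ _ _ ha]
      exact Submodule.subset_span hx
    · rw [decompProj_ne _ _ _ h _ ha]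
      exact zero_mem _
  | zero => intro i; rw [map_zero]; exact zero_mem _
  | add x y _ _ hx hy => intro i; rw [map_add]; exact add_mem (hx i) (hy i)
  | smul r x _ hx =>
    induction r using DirectSum.Decomposition.inductionOn 𝒜 with
    | zero => intro i; rw [zero_smul, map_zero]; exact zero_mem _
    | @homogeneous e r =>
      intro i
      rw [M.decompProj_smul r.2]
      exact Submodule.smul_mem _ _ (hx _)
    | add r r' hr hr' => intro i; rw [add_smul, map_add]; exact add_mem (hr i) (hr' i)

theorem exists_homogeneous_generators (M : GrMod.{u, v} 𝒜) [Module.Finite A M.carrier] :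
    ∃ (n : ℕ) (x : Fin n → M.carrier),
      (∀ i, ∃ a, x i ∈ M.deg a) ∧ Submodule.span A (Set.range x) = ⊤ := by
  classical
  obtain ⟨s, hs⟩ := Module.Finite.fg_top (R := A) (M := M.carrier)
  choose t ht using fun x : M.carrier => sum_decompProj M.deg x
  let T : Finset M.carrier := s.biUnion fun x => (t x).image fun i => decompProj M.deg i x
  refine ⟨T.card, fun i => T.equivFin.symm i, fun i => ?_, ?_⟩
  · obtain ⟨x, -, hx⟩ := Finset.mem_biUnion.1 (T.equivFin.symm i).2
    obtain ⟨j, -, hj⟩ := Finset.mem_image.1 hx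
    have : (T.equivFin.symm i : M.carrier) ∈ M.deg j := hj ▸ decompProj_mem M.deg j x
    exact ⟨j, this⟩
  · have hT : Set.range (fun i => (T.equivFin.symm i : M.carrier)) = T :=
      (T.equivFin.symm.surjective.range_comp Subtype.val).trans Subtype.range_coe
    rw [hT, eq_top_iff, ← hs, Submodule.span_le]
    intro x hx
    rw [ht x]
    exact sum_mem fun i hi => Submodule.subset_span
      (Finset.mem_biUnion.2 ⟨x, hx, Finset.mem_image_of_mem _ hi⟩)

theorem prop_of_span_range_eq_top [GradedAlgebra 𝒜] (P : ObjectProperty (GrMod.{u, v} 𝒜))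
    [P.IsClosedUnderExtensions] (hP : ∀ M : GrMod.{u, v} 𝒜, M.IsGradedCyclic → P M) {n : ℕ}
    (M : GrMod.{u, v} 𝒜) (x : Fin n → M.carrier) (hx : ∀ i, ∃ a, x i ∈ M.deg a)
    (hspan : Submodule.span A (Set.range x) = ⊤) : P M := by
  induction n generalizing M with
  | zero =>
    refine hP M ⟨0, 0, zero_mem _, ?_⟩
    rw [← hspan, Set.range_eq_empty, Submodule.span_empty, Submodule.span_zero_singleton]
  | succ n ih =>
    let N := Submodule.span A {x 0}
    have hN : N.IsHomogeneous M.deg := M.span_isHomogeneous _ (by rintro _ rfl; exact hx 0)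
    have hx0 : x 0 ∈ N := Submodule.mem_span_singleton_self _
    have hsub : (M.sub N hN).IsGradedCyclic := by
      obtain ⟨a, ha⟩ := hx 0
      have hs : Submodule.span A {(⟨x 0, hx0⟩ : N)} = ⊤ := by
        refine Submodule.map_injective_of_injective N.injective_subtype ?_
        rw [Submodule.map_span, Set.image_singleton]
        exact N.map_subtype_top.symm
      exact ⟨a, _, ha, hs⟩
    let π := lin (M.quotπ N hN)
    have hπ : LinearMap.range π = ⊤ := N.range_mkQ
    have hπ0 : π (x 0) = 0 := (Submodule.Quotient.mk_eq_zero N).2 hx0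
    have hquot : Submodule.span A (Set.range fun i : Fin n => π (x i.succ)) = ⊤ := by
      rw [← hπ, LinearMap.range_eq_map, ← hspan, Submodule.map_span, ← Set.range_comp,
        Fin.range_fin_succ, Function.comp_apply, hπ0, Submodule.span_insert_zero]
      rfl
    exact P.prop_X₂_of_shortExact (M.shortExact_sub_quot N hN) (hP _ hsub)
      (ih (M.quot N hN) _ (fun i => (hx i.succ).imp fun _ ha => lin_mem (M.quotπ N hN) ha) hquot)

theorem prop_of_finite [GradedAlgebra 𝒜] (P : ObjectProperty (GrMod.{u, v} 𝒜))
    [P.IsClosedUnderExtensions] (hP : ∀ M : GrMod.{u, v} 𝒜, M.IsGradedCyclic → P M)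
    (M : GrMod.{u, v} 𝒜) [Module.Finite A M.carrier] : P M := by
  obtain ⟨n, x, hx, hspan⟩ := M.exists_homogeneous_generators
  exact prop_of_span_range_eq_top P hP M x hx hspan

/-- A graded module whose components of sufficiently negative degree vanish. -/
def IsBoundedBelow (D : GrMod.{u, v} 𝒜) : Prop :=
  ∀ᶠ i in Filter.atBot, D.deg i = ⊥

/-- The property of graded modules `M` that the graded module `⨁ l, Ext^n(M, D(l))` is bounded
below. -/
def extBoundedBelow (D : GrMod.{u, u} 𝒜) (n : ℕ) : ObjectProperty (GrMod.{u, u} 𝒜) :=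
  fun M => ∀ᶠ l in Filter.atBot, extVanishing (D.twist l) n M

instance (D : GrMod.{u, u} 𝒜) (n : ℕ) : (extBoundedBelow D n).IsClosedUnderExtensions where
  prop_X₂_of_shortExact hS h₁ h₃ := by
    filter_upwards [h₁, h₃] with l h₁ h₃
    exact ObjectProperty.prop_X₂_of_shortExact _ hS h₁ h₃

theorem hom_eq_zero_of_deg_eq_bot {M N : GrMod.{u, v} 𝒜} {a : ℤ} {x : M.carrier}
    (hx : x ∈ M.deg a) (hspan : Submodule.span A {x} = ⊤) (hN : N.deg a = ⊥) (f : M ⟶ N) :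
    f = 0 := by
  have hfx : lin f x = 0 := by
    have := lin_mem f hx
    rwa [hN, AddSubgroup.mem_bot] at this
  have hf : lin f = 0 := LinearMap.ext_on (s := {x}) hspan (by rintro _ rfl; exact hfx)
  exact hom_ext fun y => LinearMap.congr_fun hf y

section

variable [GradedAlgebra 𝒜]

/-- The morphism `A(b) ⟶ M`, `b = -a`, sending `1` to an element of degree `a`. -/
noncomputable def selfTwistHom (M : GrMod.{u, u} 𝒜) {a b : ℤ} (h : a + b = 0) {x : M.carrier}
    (hx : x ∈ M.deg a) : (self 𝒜).twist b ⟶ M :=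
  mkHom (M := (self 𝒜).twist b) (LinearMap.toSpanSingleton A M.carrier x)
    (fun i r hr => M.smul_mem_deg (e := i + b) (i := a) (by lia) (a := r) hr hx)

theorem selfTwistHom_surjective {M : GrMod.{u, u} 𝒜} {a b : ℤ} (h : a + b = 0) {x : M.carrier}
    (hx : x ∈ M.deg a) (hspan : Submodule.span A {x} = ⊤) :
    Function.Surjective (lin (M.selfTwistHom h hx)) :=
  LinearMap.range_eq_top.1 ((LinearMap.range_toSpanSingleton x).trans hspan)

theorem one_mem_self_twist_deg (b : ℤ) :
    (show ((self 𝒜).twist b).carrier from (1 : A)) ∈ ((self 𝒜).twist b).deg (-b) :=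
  (self 𝒜).mem_deg_of_eq (neg_add_cancel b).symm (SetLike.GradedOne.one_mem : (1 : A) ∈ 𝒜 0)

theorem self_twist_hom_ext {b : ℤ} {M : GrMod.{u, u} 𝒜} {f g : (self 𝒜).twist b ⟶ M}
    (h : lin f (show A from 1) = lin g (show A from 1)) : f = g := by
  have hfg : lin f = lin g := LinearMap.ext_ring (R := A) h
  exact hom_ext fun y => LinearMap.congr_fun hfg y

instance (b : ℤ) : Projective ((self 𝒜).twist b) where
  factors {N M} f e he := by
    let y : M.carrier := lin f (show A from 1)
    have hy : y ∈ M.deg (-b) := lin_mem f (one_mem_self_twist_deg b)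
    obtain ⟨x, hx⟩ := surjective_of_epi e y
    refine ⟨N.selfTwistHom (neg_add_cancel b) (decompProj_mem N.deg (-b) x),
      self_twist_hom_ext ?_⟩
    calc lin e ((1 : A) • decompProj N.deg (-b) x) = decompProj M.deg (-b) (lin e x) := by
          rw [one_smul, lin_proj]
      _ = y := by rw [hx, decompProj_same _ _ _ hy]

theorem extBoundedBelow_of_finite [IsNoetherianRing A] {D : GrMod.{u, u} 𝒜}
    (hD : D.IsBoundedBelow) (n : ℕ) (M : GrMod.{u, u} 𝒜) [Module.Finite A M.carrier] :
    extBoundedBelow D n M := by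
  induction n generalizing M with
  | zero =>
    refine prop_of_finite _ ?_ M
    rintro M ⟨a, x, hx, hspan⟩
    filter_upwards [(Filter.tendsto_atBot_add_const_left _ a Filter.tendsto_id).eventually hD]
      with l hl
    exact Abelian.Ext.homEquiv₀.subsingleton_congr.2
      (subsingleton_of_forall_eq 0 (hom_eq_zero_of_deg_eq_bot hx hspan hl))
  | succ n ih =>
    refine prop_of_finite _ ?_ M
    rintro M ⟨a, x, hx, hspan⟩
    let φ := M.selfTwistHom (add_neg_cancel a) hx
    have : Module.Finite A (ker φ).carrier :=
      inferInstanceAs (Module.Finite A (LinearMap.ker (LinearMap.toSpanSingleton A M.carrier x)))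
    filter_upwards [ih (ker φ)] with l hl
    exact extVanishing.X₃_of_shortExact (shortExact_kerι φ (selfTwistHom_surjective _ hx hspan)) hl
      (Abelian.Ext.subsingleton_of_projective _ _ _)

end

/-- Multiplication by a homogeneous element of degree `e`, as a morphism `M(-e) ⟶ M`. -/
noncomputable def smulHom (M : GrMod.{u, v} 𝒜) {e : ℤ} {r : A} (hr : r ∈ 𝒜 e) :
    M.twist (-e) ⟶ M :=
  mkHom (M := M.twist (-e)) (LinearMap.lsmul A M.carrier r)
    (fun i x hx => M.smul_mem_deg (i := i + -e) (by lia) (x := x) hr hx)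

theorem extVanishing_of_injective_smulHom {D M : GrMod.{u, u} 𝒜} {n : ℕ} {e : ℤ} (he : 0 < e)
    {r : A} (hr : r ∈ 𝒜 e) (hinj : Function.Injective (lin (M.smulHom hr)))
    (hbdd : extBoundedBelow D n M)
    (hcoker : ∀ l, extVanishing (D.twist l) (n + 1) (coker (M.smulHom hr))) (l : ℤ) :
    extVanishing (D.twist l) n M := by
  obtain ⟨B, hB⟩ := Filter.eventually_atBot.1 hbdd
  induction l using Int.strongRec (m := B) with
  | lt l hl => exact hB l hl.le
  | ge l _ ih =>
    have hM : extVanishing (D.twist (l - e)) n M := ih (l - e) (by lia)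
    exact (extVanishing_twist_iff (sub_eq_add_neg l e).symm).1
      (extVanishing.X₁_of_shortExact (shortExact_cokerπ _ hinj) hM (hcoker (l - e)))

/-- The property of graded modules `M` that `Ext^n(M, D(l)) = 0` for all `n > d` and all `l`. -/
def extVanishingAbove (D : GrMod.{u, u} 𝒜) (d : ℕ) : ObjectProperty (GrMod.{u, u} 𝒜) :=
  fun M => ∀ n > d, ∀ l, extVanishing (D.twist l) n M

namespace extVanishingAbove

variable {D : GrMod.{u, u} 𝒜} {d : ℕ}

instance : (extVanishingAbove D d).IsClosedUnderIsomorphisms where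
  of_iso e h n hn l := ObjectProperty.prop_of_iso _ e (h n hn l)

instance : (extVanishingAbove D d).IsClosedUnderExtensions where
  prop_X₂_of_shortExact hS h₁ h₃ n hn l :=
    ObjectProperty.prop_X₂_of_shortExact _ hS (h₁ n hn l) (h₃ n hn l)

theorem of_isZero {M : GrMod.{u, u} 𝒜} (hM : IsZero M) : extVanishingAbove D d M :=
  fun _ _ _ => ObjectProperty.prop_of_isZero _ hM

theorem twist {M : GrMod.{u, u} 𝒜} (hM : extVanishingAbove D d M) (a : ℤ) :
    extVanishingAbove D d (M.twist a) :=
  fun n hn l => (extVanishing_twist_iff (sub_add_cancel l a)).2 (hM n hn _)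

end extVanishingAbove

section

variable [GradedAlgebra 𝒜]

theorem exists_sub_mem_irrelevant (hneg : ∀ e < 0, 𝒜 e = ⊥) (r : A) :
    ∃ s ∈ 𝒜 0, r - s ∈ irrelevant 𝒜 := by
  induction r using DirectSum.Decomposition.inductionOn 𝒜 with
  | zero => exact ⟨0, zero_mem _, by rw [sub_zero]; exact zero_mem _⟩
  | @homogeneous e r =>
    obtain ⟨r, hr⟩ := r
    rcases lt_trichotomy e 0 with he | rfl | he
    · obtain rfl : r = 0 := by rwa [hneg e he, Submodule.mem_bot] at hr
      exact ⟨0, zero_mem _, by rw [sub_zero]; exact zero_mem _⟩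
    · exact ⟨r, hr, by rw [sub_self]; exact zero_mem _⟩
    · exact ⟨0, zero_mem _, by rw [sub_zero]; exact Ideal.subset_span ⟨e, he, hr⟩⟩
  | add r r' ih ih' =>
    obtain ⟨s, hs, hrs⟩ := ih
    obtain ⟨s', hs', hrs'⟩ := ih'
    exact ⟨s + s', add_mem hs hs', by rw [add_sub_add_comm]; exact add_mem hrs hrs'⟩

theorem eq_irrelevant_of_le (hneg : ∀ e < 0, 𝒜 e = ⊥) (hunit : ∀ r ∈ 𝒜 0, r ≠ 0 → IsUnit r)
    {J : Ideal A} (hle : irrelevant 𝒜 ≤ J) (hJ : J ≠ ⊤) : J = irrelevant 𝒜 := by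
  refine le_antisymm (fun r hr => ?_) hle
  obtain ⟨s, hs, hrs⟩ := exists_sub_mem_irrelevant hneg r
  have hsJ : s ∈ J := (Submodule.sub_mem_iff_right J hr).1 (hle hrs)
  obtain rfl : s = 0 := by
    by_contra hs0
    exact hJ (J.eq_top_of_isUnit_mem hsJ (hunit s hs hs0))
  rwa [sub_zero] at hrs

theorem IsGradedCyclic.exists_residue_twist_iso (hneg : ∀ e < 0, 𝒜 e = ⊥)
    (hunit : ∀ r ∈ 𝒜 0, r ≠ 0 → IsUnit r) {M : GrMod.{u, u} 𝒜} (hM : M.IsGradedCyclic)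
    [Nontrivial M.carrier] (hann : irrelevant 𝒜 ≤ Module.annihilator A M.carrier) :
    ∃ a, Nonempty ((residue 𝒜).twist a ≅ M) := by
  obtain ⟨a, x, hx, hspan⟩ := hM
  let φ := LinearMap.toSpanSingleton A M.carrier x
  have hker : LinearMap.ker φ = irrelevant 𝒜 := by
    rw [← Submodule.annihilator_span_singleton, hspan, Submodule.annihilator_top]
    exact eq_irrelevant_of_le hneg hunit hann
      (mt Module.annihilator_eq_top_iff.1 (not_subsingleton M.carrier))
  let ψ : (residue 𝒜).twist (-a) ⟶ M :=
    mkHom (M := (residue 𝒜).twist (-a)) (Submodule.liftQ (irrelevant 𝒜) φ hker.ge) (by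
      rintro i _ ⟨r, hr, rfl⟩
      exact M.smul_mem_deg (e := i + -a) (i := a) (by lia) (a := r) hr hx)
  have hψ : Function.Bijective (lin ψ) :=
    ⟨LinearMap.ker_eq_bot.1 (Submodule.ker_liftQ_eq_bot _ _ hker.ge hker.le),
      LinearMap.range_eq_top.1 ((Submodule.range_liftQ _ _ _).trans
        ((LinearMap.range_toSpanSingleton x).trans hspan))⟩
  have := isIso_of_bijective ψ hψ
  exact ⟨-a, ⟨asIso ψ⟩⟩

theorem extVanishingAbove.of_isGradedCyclic [IsNoetherianRing A] (hneg : ∀ e < 0, 𝒜 e = ⊥)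
    (hunit : ∀ r ∈ 𝒜 0, r ≠ 0 → IsUnit r) {D : GrMod.{u, u} 𝒜} (hD : D.IsBoundedBelow) {d : ℕ}
    (hres : extVanishingAbove D d (residue 𝒜)) (M : GrMod.{u, u} 𝒜) (hM : M.IsGradedCyclic) :
    extVanishingAbove D d M := by
  induction hI : Module.annihilator A M.carrier using WellFoundedGT.induction generalizing M with
  | ind I ih =>
  subst hI
  rcases subsingleton_or_nontrivial M.carrier with hM0 | hM0
  · exact of_isZero (isZero_iff_subsingleton.2 hM0)
  by_cases hann : irrelevant 𝒜 ≤ Module.annihilator A M.carrier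
  · obtain ⟨a, ⟨i⟩⟩ := hM.exists_residue_twist_iso hneg hunit hann
    exact ObjectProperty.prop_of_iso _ i (hres.twist a)
  obtain ⟨r, ⟨e, he, hr⟩, hrM⟩ := Set.not_subset.1 (mt Ideal.span_le.2 hann)
  have hcoker : extVanishingAbove D d (coker (M.smulHom hr)) :=
    ih _ (annihilator_lt_annihilator_quot_range_lsmul hrM) _
      (hM.of_surjective (cokerπ _) (Submodule.mkQ_surjective _)) rfl
  by_cases hinj : Function.Injective (lin (M.smulHom hr))
  · have := hM.finite
    exact fun n hn => extVanishing_of_injective_smulHom he hr hinj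
      (extBoundedBelow_of_finite hD n M) (hcoker (n + 1) (by lia))
  · have ⟨_, x, _, hspan⟩ := hM
    have hrange := ih _ (annihilator_lt_annihilator_range_lsmul hspan hinj) _
      ((hM.twist (-e)).range (M.smulHom hr)) rfl
    exact ObjectProperty.prop_X₂_of_shortExact _
      (M.shortExact_sub_quot _ (range_isHomogeneous (M.smulHom hr))) hrange hcoker

end

theorem isZero_uExt_iff [GradedAlgebra 𝒜] {C : CochainComplex (GrMod.{u, u} 𝒜) ℤ}
    {D : GrMod.{u, u} 𝒜} {j : ℤ} : IsZero (uExt C D j) ↔ ∀ i, ∀ x : ExtDeg C D j i, x = 0 := by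
  rw [isZero_iff_subsingleton]
  change Subsingleton (DirectSum ℤ (ExtDeg C D j)) ↔ _
  refine ⟨fun _ i x => DirectSum.of_injective i (Subsingleton.elim _ _), fun h => ?_⟩
  have (i : ℤ) : Subsingleton (ExtDeg C D j i) := subsingleton_of_forall_eq 0 (h i)
  infer_instance

theorem finite_homology [IsNoetherianRing A] (C : CochainComplex (GrMod.{u, u} 𝒜) ℤ) (n : ℤ)
    [Module.Finite A (C.X n).carrier] : Module.Finite A (C.homology n).carrier := by
  have : Module.Finite A (C.cycles n).carrier :=
    Module.Finite.of_injective (lin (C.iCycles n)) (injective_of_mono _)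
  exact Module.Finite.of_surjective (lin (C.homologyπ n)) (surjective_of_epi _)

end GrMod

theorem proposition3p1_general {k A : Type u} [CommRing k] [CommRing A] [Algebra k A]
    {𝒜 : ℤ → Submodule k A} [GradedAlgebra 𝒜] [IsNoetherianRing A]
    (hneg : ∀ e < 0, 𝒜 e = ⊥) (hunit : ∀ r ∈ 𝒜 0, r ≠ 0 → IsUnit r)
    {D : GrMod.{u, u} 𝒜} (hD : D.IsBoundedBelow) {d : ℕ}
    (hres : ∀ i : ℤ, i > d → IsZero (GrMod.uExt
      ((CochainComplex.singleFunctor (GrMod.{u, u} 𝒜) 0).obj (GrMod.residue 𝒜)) D i))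
    (C : CochainComplex (GrMod.{u, u} 𝒜) ℤ)
    (hC : ∀ i : ℤ, Module.Finite A (C.homology i).carrier)
    (s t : ℤ) (hH : ∀ j : ℤ, ¬ (s ≤ j ∧ j ≤ t) → IsZero (C.homology j))
    (j : ℤ) (hj : ¬ (-t ≤ j ∧ j ≤ (d : ℤ) - s)) : IsZero (GrMod.uExt C D j) := by
  have hres' : GrMod.extVanishingAbove D d (GrMod.residue 𝒜) := fun n hn l =>
    Abelian.Ext.homEquiv.subsingleton_congr.2
      (subsingleton_of_forall_eq 0 (GrMod.isZero_uExt_iff.1 (hres n (by exact_mod_cast hn)) l))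
  have hExt (n : ℤ) : GrMod.extVanishingAbove D d (C.homology n) :=
    GrMod.prop_of_finite _ (GrMod.extVanishingAbove.of_isGradedCyclic hneg hunit hD hres') _
  exact GrMod.isZero_uExt_iff.2 fun i =>
    Q_obj_hom_shift_eq_zero hH fun n hs ht m hm => hExt n m (by lia) i

section StandardGrading

theorem weight_const_one {σ R : Type*} [AddCommMonoidWithOne R] (m : σ →₀ ℕ) :
    Finsupp.weight (fun _ => (1 : R)) m = m.degree := by
  simp only [Finsupp.weight_apply, Finsupp.degree_apply, Finsupp.sum, nsmul_one, Nat.cast_sum]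

theorem polyGrading_eq_bot (k : Type u) [Field k] (n : ℕ) {e : ℤ} (he : e < 0) :
    polyGrading k n e = ⊥ := by
  refine (Submodule.eq_bot_iff _).2 fun p hp => MvPolynomial.ext _ _ fun m => ?_
  refine MvPolynomial.IsWeightedHomogeneous.coeff_eq_zero hp m ?_
  rw [weight_const_one]
  lia

theorem polyGrading_natCast (k : Type u) [Field k] (n e : ℕ) :
    polyGrading k n e = MvPolynomial.homogeneousSubmodule (Fin (n + 1)) k e := by
  ext p
  rw [polyGrading, MvPolynomial.mem_weightedHomogeneousSubmodule,
    MvPolynomial.mem_homogeneousSubmodule]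
  simp only [MvPolynomial.IsHomogeneous, MvPolynomial.IsWeightedHomogeneous, Pi.one_def,
    weight_const_one, Nat.cast_inj, Nat.cast_id]

theorem isUnit_of_mem_polyGrading_zero {k : Type u} [Field k] {n : ℕ}
    {p : MvPolynomial (Fin (n + 1)) k} (hp : p ∈ polyGrading k n 0) (hp0 : p ≠ 0) : IsUnit p := by
  rw [← Nat.cast_zero, polyGrading_natCast, MvPolynomial.homogeneousSubmodule_zero] at hp
  obtain ⟨c, rfl⟩ := Submodule.mem_one.1 hp
  have hc : c ≠ 0 := by
    rintro rfl
    exact hp0 (map_zero _)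
  exact hc.isUnit.map _

variable {k A : Type u} [CommRing k] [CommRing A] [Algebra k A] {𝒜 : ℤ → Submodule k A}
  [GradedAlgebra 𝒜] (I : HomogeneousIdeal 𝒜)

theorem quotGrading_eq_bot {e : ℤ} (he : 𝒜 e = ⊥) : quotGrading I e = ⊥ := by
  rw [quotGrading, he, Submodule.map_bot]

theorem isUnit_of_mem_quotGrading {e : ℤ} (hunit : ∀ r ∈ 𝒜 e, r ≠ 0 → IsUnit r)
    {r : A ⧸ I.toIdeal} (hr : r ∈ quotGrading I e) (hr0 : r ≠ 0) : IsUnit r := by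
  obtain ⟨p, hp, rfl⟩ := hr
  have hp0 : p ≠ 0 := by
    rintro rfl
    exact hr0 (map_zero _)
  exact (hunit p hp hp0).map (Ideal.Quotient.mk I.toIdeal)

end StandardGrading

theorem proposition3p1 {k : Type u} [Field k] (n : ℕ) (I : HomogeneousIdeal (polyGrading k n))
    (hG : IsGradedGorenstein (quotGrading I))
    (d : ℕ) (hd : ringKrullDim (MvPolynomial (Fin (n + 1)) k ⧸ I.toIdeal) = d)
    (C : CochainComplex (GrMod.{u, u} (quotGrading I)) ℤ)
    (hC : ∀ i : ℤ, Module.Finite (MvPolynomial (Fin (n + 1)) k ⧸ I.toIdeal) (C.X i).carrier)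
    (s t : ℤ) (hH : ∀ j : ℤ, ¬ (s ≤ j ∧ j ≤ t) → IsZero (C.homology j))
    (j : ℤ) (hj : ¬ (-t ≤ j ∧ j ≤ (d : ℤ) - s)) :
    IsZero (GrMod.uExt C (GrMod.self (quotGrading I)) j) := by
  obtain ⟨d', hd', -, hres⟩ := hG
  obtain rfl : d' = d := by rw [hd] at hd'; exact_mod_cast hd'.symm
  have hneg (e : ℤ) (he : e < 0) : quotGrading I e = ⊥ :=
    quotGrading_eq_bot I (polyGrading_eq_bot k n he)
  have hbdd : (GrMod.self (quotGrading I)).IsBoundedBelow := by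
    filter_upwards [Filter.eventually_lt_atBot 0] with e he
    exact congrArg Submodule.toAddSubgroup (hneg e he)
  exact proposition3p1_general hneg
    (fun _ => isUnit_of_mem_quotGrading I fun _ => isUnit_of_mem_polyGrading_zero) hbdd
    (fun i hi => hres i hi.ne') C (fun i => GrMod.finite_homology C i) s t hH j hj
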